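/- Let $N\ge 1$, let $\mathbb{K}$ be a field (for instance $\mathbb{Q}(q,t)$), and let $q,t\in\mathbb{K}$ be nonzero and generic: $q^at^b\neq 1$ for all integers $(a,b)\ne(0,0)$ with $-N\le b\le N$. Put $\mathcal{P}=\mathbb{K}[x_1,\dots,x_N]$. Let $\tau$ be a partition of $N$. A reverse standard Young tableau (RSYT) $S$ of shape $\tau$ is a filling of the Ferrers diagram of $\tau$ with $1,\dots,N$, each used once, that decreases along each row and each column; $\mathcal{Y}(\tau)$ is the set of these, $\mathrm{row}(i,S)$ and $\mathrm{col}(i,S)$ give the position of the entry $i$, $c(i,S)=\mathrm{col}(i,S)-\mathrm{row}(i,S)$ is its content, and $S^{(i)}$ is $S$ with $i$ and $i+1$ exchanged. Let $V_\tau$ be the $\mathbb{K}$-space with basis $\mathcal{Y}(\tau)$. Operators are written on the right, the leftmost factor acting first. For $1\le i<N$ and $b=c(i,S)-c(i+1,S)$ let $S\tau(T_i)$ be: $tS$ if $i,i+1$ are in the same row of $S$; $-S$ if they are in the same column; $S^{(i)}+\frac{t-1}{1-t^{-b}}S$ if $b\ge 2$; $\frac{t(t^{b+1}-1)(t^{b-1}-1)}{(t^b-1)^2}S^{(i)}+\frac{t^b(t-1)}{t^b-1}S$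 if $b\le-2$. With $u(z)=\frac{(t-z)(1-tz)}{(1-z)^2}$ let $\langle\cdot,\cdot\rangle_0$ be the bilinear form on $V_\tau$ with $\langle S,S'\rangle_0=\delta_{S,S'}\prod_{i<j,\;c(j,S)-c(i,S)\ge2}u(t^{c(i,S)-c(j,S)})$, and $\|S\|_0^2=\langle S,S\rangle_0$. Let $\mathcal{P}_\tau=\mathcal{P}\otimes V_\tau$. Writing $x.s_i$ for $x$ with $x_i,x_{i+1}$ exchanged, define on $\mathcal{P}_\tau$ $$(p\otimes S)\boldsymbol{T}_i=(1-t)x_{i+1}\tfrac{p(x)-p(x.s_i)}{x_i-x_{i+1}}\otimes S+p(x.s_i)\otimes S\tau(T_i),\qquad \boldsymbol{T}_i^{-1}=\tfrac1t(\boldsymbol{T}_i+1-t),$$ $$(p\otimes S)\boldsymbol{w}=p(qx_N,x_1,\dots,x_{N-1})\otimes S\tau(T_1)\tau(T_2)\cdots\tau(T_{N-1}),$$ $$\boldsymbol{\xi}_N=\boldsymbol{T}_{N-1}^{-1}\cdots\boldsymbol{T}_1^{-1}\boldsymbol{w},\qquad \boldsymbol{w}^*=\boldsymbol{T}_{N-1}^{-1}\cdots\boldsymbol{T}_1^{-1}\boldsymbol{w}\boldsymbol{T}_{N-1}\cdots\boldsymbol{T}_1,\qquad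 f\mathcal{D}_N=(f-f\boldsymbol{\xi}_N)/x_N.$$ A symmetric bilinear form $\langle\cdot,\cdot\rangle$ on $\mathcal{P}_\tau$ satisfies (BF2) if for all $f,g\in\mathcal{P}_\tau$, $S,S'\in\mathcal{Y}(\tau)$ and $1\le i<N$: $\langle 1\otimes S,1\otimes S'\rangle=\langle S,S'\rangle_0$; $\langle f\boldsymbol{T}_i,g\rangle=\langle f,g\boldsymbol{T}_i\rangle$; $\langle f\boldsymbol{\xi}_N,g\rangle=\langle f,g\boldsymbol{\xi}_N\rangle$; $\langle f\mathcal{D}_N,g\rangle=(1-q)\langle f,x_N(g\boldsymbol{w}^*\boldsymbol{w})\rangle$. For $\alpha\in\mathbb{N}_0^N$ let $r_\alpha(i)=\#\{j:\alpha_j>\alpha_i\}+\#\{j\le i:\alpha_j=\alpha_i\}$ and $\zeta_{\alpha,S}(i)=q^{\alpha_i}t^{c(r_\alpha(i),S)}$. The vector-valued nonsymmetric Macdonald polynomials $M_{\alpha,S}\in\mathcal{P}_\tau$ are those produced by the Yang–Baxter graph, that is, by starting from $M_{\boldsymbol{0},S}=1\otimes S$ and applying any sequence of the following steps: * if $\alpha_i<\alpha_{i+1}$: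 $M_{\alpha.s_i,S}=M_{\alpha,S}\boldsymbol{T}_i+\frac{t-1}{\zeta_{\alpha,S}(i+1)/\zeta_{\alpha,S}(i)-1}M_{\alpha,S}$, where $\alpha.s_i$ is $\alpha$ with $\alpha_i,\alpha_{i+1}$ exchanged; * if $\alpha_i=\alpha_{i+1}$, $j=r_\alpha(i)$ and $c(j,S)-c(j+1,S)\ge2$: $M_{\alpha,S^{(j)}}=M_{\alpha,S}\boldsymbol{T}_i+\frac{t-1}{\zeta_{\alpha,S}(i+1)/\zeta_{\alpha,S}(i)-1}M_{\alpha,S}$; * $M_{\alpha\Phi,S}=x_N(M_{\alpha,S}\boldsymbol{w})$, where $\alpha\Phi=(\alpha_2,\dots,\alpha_N,\alpha_1+1)$. For $m\ge0$ let $(z;q)_m=\prod_{l=1}^{m}(1-zq^{l-1})$. **Theorem.** Suppose the symmetric bilinear form $\langle\cdot,\cdot\rangle$ on $\mathcal{P}_\tau$ satisfies (BF2), $\lambda\in\mathbb{N}_0^N$ is a partition ($\lambda_1\ge\dots\ge\lambda_N$) and $S\in\mathcal{Y}(\tau)$. Then the graph produces a polynomial $M_{\lambda,S}$, and for every sequence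 of steps that leads to $(\lambda,S)$ the resulting $M_{\lambda,S}$ satisfies, with $\|f\|^2=\langle f,f\rangle$, $|\lambda|=\sum_i\lambda_i$ and $k(\lambda)=\sum_{i=1}^N(N-2i+1)\lambda_i$, $$\|M_{\lambda,S}\|^2=t^{k(\lambda)}\|S\|_0^2\,(1-q)^{-|\lambda|}\prod_{i=1}^N\left(qt^{c(i,S)};q\right)_{\lambda_i}\prod_{1\le i<j\le N}\frac{\left(qt^{c(i,S)-c(j,S)-1};q\right)_{\lambda_i-\lambda_j}\left(qt^{c(i,S)-c(j,S)+1};q\right)_{\lambda_i-\lambda_j}}{\left(qt^{c(i,S)-c(j,S)};q\right)_{\lambda_i-\lambda_j}^2}.$$ -/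

import Mathlib

open scoped TensorProduct

namespace VectorMacdonald

noncomputable section

/-! Throughout, the number of variables is `N = n + 1`.  The indices `1, ..., N` are the elements of
`Fin (n + 1)` (shifted by one), and the indices `1, ..., N - 1` of the Hecke algebra generators are
the elements `i` of `Fin n`, where `i.castSucc` stands for `i` and `i.succ` for `i + 1`. -/

/-- The polynomials `K[x_1, ..., x_N]`. -/
abbrev Poly (K : Type*) [Field K] (n : ℕ) : Type _ := MvPolynomial (Fin (n + 1)) K

/-! ### Reverse standard Young tableaux -/

/-- A reverse standard Young tableau of shape `τ`: a filling of the boxes of `τ` with `1, ..., N`,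
each used once, decreasing along rows and down columns.  It is recorded by the box `pos a`,
as a pair (row, column), in which the entry `a` stands. -/
@[ext]
structure RSYT (n : ℕ) (τ : YoungDiagram) where
  pos : Fin (n + 1) ≃ {c : ℕ × ℕ // c ∈ τ}
  row_decreasing : ∀ a b, (pos a).1.1 = (pos b).1.1 → (pos a).1.2 < (pos b).1.2 → b < a
  col_decreasing : ∀ a b, (pos a).1.2 = (pos b).1.2 → (pos a).1.1 < (pos b).1.1 → b < a

namespace RSYT

variable {n : ℕ} {τ : YoungDiagram}

/-- The row of the entry `a`. -/
def row (S : RSYT n τ) (a : Fin (n + 1)) : ℕ := (S.pos a).1.1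

/-- The column of the entry `a`. -/
def col (S : RSYT n τ) (a : Fin (n + 1)) : ℕ := (S.pos a).1.2

/-- The content of the entry `a`. -/
def content (S : RSYT n τ) (a : Fin (n + 1)) : ℤ := (S.col a : ℤ) - (S.row a : ℤ)

theorem lt_of_swap_lt (i : Fin n) (a b : Fin (n + 1))
    (h : Equiv.swap i.castSucc i.succ b < Equiv.swap i.castSucc i.succ a)
    (hne : ¬ (Equiv.swap i.castSucc i.succ b = i.castSucc ∧
      Equiv.swap i.castSucc i.succ a = i.succ)) : b < a := by
  rw [Equiv.swap_apply_def, Equiv.swap_apply_def] at h hne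
  simp only [Fin.lt_def, Fin.ext_iff, Fin.val_castSucc, Fin.val_succ] at *
  split_ifs at h hne <;> simp_all <;> omega

open Classical in
/-- The tableau obtained by exchanging the entries `i` and `i + 1`.  When these stand in the same
row or column the exchange is not a tableau, and the value is `S` by convention. -/
def exchange (S : RSYT n τ) (i : Fin n) : RSYT n τ :=
  if h : S.row i.castSucc ≠ S.row i.succ ∧ S.col i.castSucc ≠ S.col i.succ then
    { pos := (Equiv.swap i.castSucc i.succ).trans S.pos
      row_decreasing := by
        intro a b h1 h2
        refine lt_of_swap_lt i a b (S.row_decreasing _ _ h1 h2) ?_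
        rintro ⟨hb, ha⟩
        simp only [Equiv.trans_apply, ha, hb] at h1
        exact h.1 h1.symm
      col_decreasing := by
        intro a b h1 h2
        refine lt_of_swap_lt i a b (S.col_decreasing _ _ h1 h2) ?_
        rintro ⟨hb, ha⟩
        simp only [Equiv.trans_apply, ha, hb] at h1
        exact h.2 h1.symm }
  else S

end RSYT

/-! ### The Hecke algebra representation on `V_τ` -/

/-- The space `V_τ` with basis the tableaux of shape `τ`. -/
abbrev V (K : Type*) [Field K] (n : ℕ) (τ : YoungDiagram) : Type _ := RSYT n τ →₀ K

section

variable {K : Type*} [Field K] {n : ℕ} {τ : YoungDiagram}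

/-- The basis vector of `V_τ` given by the tableau `S`. -/
def basisVec (K : Type*) [Field K] {n : ℕ} {τ : YoungDiagram} (S : RSYT n τ) : V K n τ :=
  Finsupp.single S 1

/-- The value of `τ(T_i)` on the basis vector `S`. -/
def tauOnTableau (t : K) (i : Fin n) (S : RSYT n τ) : V K n τ :=
  if S.row i.castSucc = S.row i.succ then
    t • basisVec K S
  else if S.col i.castSucc = S.col i.succ then
    -basisVec K S
  else if S.row i.castSucc < S.row i.succ then
    basisVec K (S.exchange i)
      + ((t - 1) / (1 - t ^ (S.content i.succ - S.content i.castSucc))) • basisVec K S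
  else
    (t * (t ^ (S.content i.castSucc - S.content i.succ + 1) - 1)
        * (t ^ (S.content i.castSucc - S.content i.succ - 1) - 1)
        / (t ^ (S.content i.castSucc - S.content i.succ) - 1) ^ 2) • basisVec K (S.exchange i)
      + (t ^ (S.content i.castSucc - S.content i.succ) * (t - 1)
        / (t ^ (S.content i.castSucc - S.content i.succ) - 1)) • basisVec K S

/-- The operator `τ(T_i)` on `V_τ`. -/
def tauT (t : K) (i : Fin n) : V K n τ →ₗ[K] V K n τ :=
  Finsupp.linearCombination K (tauOnTableau t i)

/-- `u(z) = (t - z)(1 - z t) / (1 - z)²`. -/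
def u (t z : K) : K := (t - z) * (1 - z * t) / (1 - z) ^ 2

/-- The value `⟨S, S⟩_0`. -/
def tableauNorm (t : K) (S : RSYT n τ) : K :=
  ∏ i, ∏ j ∈ Finset.univ.filter (fun j => i < j ∧ 2 ≤ S.content j - S.content i),
    u t (t ^ (S.content i - S.content j))

/-- The bilinear form `⟨·, ·⟩_0` on `V_τ`, for which distinct tableaux are orthogonal. -/
def form₀ (t : K) : V K n τ →ₗ[K] V K n τ →ₗ[K] K :=
  Finsupp.linearCombination K (fun S => tableauNorm t S • Finsupp.lapply S)

/-- For operators written on the right, `rightProd A [i₁, ..., iₘ]` is `f ↦ f A_{i₁} ... A_{iₘ}`: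
the operator `A_{i₁}` is applied first. -/
def rightProd {ι W : Type*} [AddCommGroup W] [Module K W] (A : ι → (W →ₗ[K] W)) :
    List ι → (W →ₗ[K] W)
  | [] => LinearMap.id
  | i :: l => rightProd A l ∘ₗ A i

/-- `τ(ω)` with `ω = T_1 T_2 ... T_{N-1}`, acting on the right. -/
def tauOmega (t : K) : V K n τ →ₗ[K] V K n τ := rightProd (tauT t) (List.finRange n)

/-! ### Operators on polynomials -/

/-- `p ↦ p s_i`, the exchange of `x_i` and `x_{i+1}`. -/
def swapVars (K : Type*) [Field K] {n : ℕ} (i : Fin n) : Poly K n →ₐ[K] Poly K n :=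
  MvPolynomial.rename (Equiv.swap i.castSucc i.succ)

theorem sub_ne_zero_vars (i : Fin n) :
    (MvPolynomial.X i.castSucc - MvPolynomial.X i.succ : Poly K n) ≠ 0 := by
  rw [sub_ne_zero]
  intro h
  exact (Fin.castSucc_lt_succ (i := i)).ne (MvPolynomial.X_injective h)

theorem dvd_sub_swapVars (i : Fin n) (p : Poly K n) :
    (MvPolynomial.X i.castSucc - MvPolynomial.X i.succ : Poly K n) ∣ p - swapVars K i p := by
  induction p using MvPolynomial.induction_on with
  | C a => simp [swapVars]
  | add p r hp hr =>
    have : p + r - swapVars K i (p + r) = (p - swapVars K i p) + (r - swapVars K i r) := by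
      rw [map_add]; ring
    rw [this]
    exact dvd_add hp hr
  | mul_X p j hp =>
    have : p * MvPolynomial.X j - swapVars K i (p * MvPolynomial.X j)
        = (p - swapVars K i p) * MvPolynomial.X j
          + swapVars K i p * (MvPolynomial.X j - swapVars K i (MvPolynomial.X j)) := by
      rw [map_mul]; ring
    rw [this]
    refine dvd_add (hp.mul_right _) (Dvd.dvd.mul_left ?_ _)
    simp only [swapVars, MvPolynomial.rename_X, Equiv.swap_apply_def]
    split_ifs with h1 h2
    · rw [h1]
    · rw [h2]
      exact ⟨-1, by ring⟩
    · simp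

/-- The divided difference `p ↦ (p(x) - p(x.s_i)) / (x_i - x_{i+1})`, the quotient being exact. -/
def divDiff (K : Type*) [Field K] {n : ℕ} (i : Fin n) : Poly K n →ₗ[K] Poly K n where
  toFun p := (dvd_sub_swapVars i p).choose
  map_add' p r := by
    apply mul_left_cancel₀ (sub_ne_zero_vars (K := K) i)
    rw [mul_add, ← (dvd_sub_swapVars i (p + r)).choose_spec,
      ← (dvd_sub_swapVars i p).choose_spec, ← (dvd_sub_swapVars i r).choose_spec, map_add]
    ring
  map_smul' c p := by
    apply mul_left_cancel₀ (sub_ne_zero_vars (K := K) i)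
    rw [RingHom.id_apply, mul_smul_comm, ← (dvd_sub_swapVars i (c • p)).choose_spec,
      ← (dvd_sub_swapVars i p).choose_spec, map_smul, smul_sub]

theorem mul_divDiff (i : Fin n) (p : Poly K n) :
    (MvPolynomial.X i.castSucc - MvPolynomial.X i.succ) * divDiff K i p = p - swapVars K i p :=
  ((dvd_sub_swapVars i p).choose_spec).symm

/-- `p(x) ↦ p(q x_N, x_1, ..., x_{N-1})`. -/
def shift (n : ℕ) (q : K) : Poly K n →ₐ[K] Poly K n :=
  MvPolynomial.aeval
    (Fin.cases (MvPolynomial.C q * MvPolynomial.X (Fin.last n))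
      (fun i : Fin n => MvPolynomial.X i.castSucc))

/-- Division by `x_N` (monomials that do not contain `x_N` are dropped). -/
def divLast (K : Type*) [Field K] (n : ℕ) : Poly K n →ₗ[K] Poly K n where
  toFun p := MvPolynomial.divMonomial p (Finsupp.single (Fin.last n) 1)
  map_add' p r := MvPolynomial.add_divMonomial p r _
  map_smul' c p := by
    ext m
    simp [MvPolynomial.coeff_divMonomial]

end

/-! ### Vector-valued polynomials -/

/-- The space `P_τ = P ⊗ V_τ` of vector-valued polynomials. -/
abbrev PolyV (K : Type*) [Field K] (n : ℕ) (τ : YoungDiagram) : Type _ := Poly K n ⊗[K] V K n τ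

section

variable {K : Type*} [Field K] {n : ℕ} {τ : YoungDiagram}

/-- Multiplication by `x_N`. -/
def mulXLast (K : Type*) [Field K] (n : ℕ) (τ : YoungDiagram) : PolyV K n τ →ₗ[K] PolyV K n τ :=
  TensorProduct.map (LinearMap.mulLeft K (MvPolynomial.X (Fin.last n))) LinearMap.id

/-- The operator `𝐓_i`. -/
def opT (t : K) (i : Fin n) : PolyV K n τ →ₗ[K] PolyV K n τ :=
  (1 - t) • TensorProduct.map (LinearMap.mulLeft K (MvPolynomial.X i.succ) ∘ₗ divDiff K i)
      LinearMap.id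
    + TensorProduct.map (swapVars K i).toLinearMap (tauT t i)

/-- The operator `𝐓_i⁻¹ = t⁻¹ (𝐓_i + 1 - t)`. -/
def opTInv (t : K) (i : Fin n) : PolyV K n τ →ₗ[K] PolyV K n τ :=
  t⁻¹ • (opT t i + (1 - t) • LinearMap.id)

/-- The operator `𝐰`. -/
def opW (q t : K) : PolyV K n τ →ₗ[K] PolyV K n τ :=
  TensorProduct.map (shift n q).toLinearMap (tauOmega t)

/-- `f ↦ f 𝐓_{N-1}⁻¹ ... 𝐓_1⁻¹ 𝐰`, which is the Cherednik operator `ξ_N`. -/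
def opXiLast (q t : K) : PolyV K n τ →ₗ[K] PolyV K n τ :=
  opW q t ∘ₗ rightProd (opTInv t) (List.finRange n).reverse

/-- `𝐰* = 𝐓_{N-1}⁻¹ ... 𝐓_1⁻¹ 𝐰 𝐓_{N-1} ... 𝐓_1`, acting on the right. -/
def opWStar (q t : K) : PolyV K n τ →ₗ[K] PolyV K n τ :=
  rightProd (opT t) (List.finRange n).reverse ∘ₗ opW q t
    ∘ₗ rightProd (opTInv t) (List.finRange n).reverse

/-- The Dunkl operator `f ↦ (f - f ξ_N) / x_N`.  Here `f - f ξ_N` is always divisible by `x_N`: at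
`x_{i+1} = 0` the operator `𝐓_i` is the exchange of variables times `τ(T_i)`, so that at `x_N = 0` the
factors `τ(T_{N-1}⁻¹ ... T_1⁻¹)` and `τ(ω)` of `ξ_N` cancel. -/
def opDLast (q t : K) : PolyV K n τ →ₗ[K] PolyV K n τ :=
  TensorProduct.map (divLast K n) LinearMap.id ∘ₗ (LinearMap.id - opXiLast q t)

/-- The hypotheses (BF2) on a symmetric bilinear form on `P_τ`. -/
structure BF2 (q t : K) (B : PolyV K n τ →ₗ[K] PolyV K n τ →ₗ[K] K) : Prop where
  symm : ∀ f g, B f g = B g f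
  const : ∀ S S' : RSYT n τ,
    B (1 ⊗ₜ basisVec K S) (1 ⊗ₜ basisVec K S') = form₀ t (basisVec K S) (basisVec K S')
  hecke : ∀ (i : Fin n) (f g), B (opT t i f) g = B f (opT t i g)
  xi : ∀ f g, B (opXiLast q t f) g = B f (opXiLast q t g)
  dunkl : ∀ f g, B (opDLast q t f) g
    = (1 - q) * B f (mulXLast K n τ (opW q t (opWStar q t g)))

/-! ### Macdonald polynomials -/

theorem rank_lt (α : Fin (n + 1) → ℕ) (i : Fin (n + 1)) :
    (Finset.univ.filter (fun j => α i < α j)).card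
      + (Finset.univ.filter (fun j => j < i ∧ α j = α i)).card < n + 1 := by
  rw [← Finset.card_union_of_disjoint]
  · calc _ < (Finset.univ : Finset (Fin (n + 1))).card := by
          apply Finset.card_lt_card
          rw [Finset.ssubset_univ_iff]
          intro h
          have := h ▸ Finset.mem_univ i
          simp at this
      _ = n + 1 := by simp
  · rw [Finset.disjoint_left]
    intro j h1 h2
    simp only [Finset.mem_filter, Finset.mem_univ, true_and] at h1 h2
    omega

/-- The rank function `r_α(i) = #{j : α_j > α_i} + #{j ≤ i : α_j = α_i}`; the index `i` itself is
left out of the second set because indices and ranks start from `0` here. -/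
def rank (α : Fin (n + 1) → ℕ) (i : Fin (n + 1)) : Fin (n + 1) :=
  ⟨(Finset.univ.filter (fun j => α i < α j)).card
      + (Finset.univ.filter (fun j => j < i ∧ α j = α i)).card, rank_lt α i⟩

/-- The spectral vector `ζ_{α,S}(i) = q^{α_i} t^{c(r_α(i), S)}`. -/
def spectral (q t : K) (α : Fin (n + 1) → ℕ) (S : RSYT n τ) (i : Fin (n + 1)) : K :=
  q ^ α i * t ^ S.content (rank α i)

/-- The element `f 𝐓_i + (t - 1) / (ζ(i+1) / ζ(i) - 1) f`. -/
def ybStep (q t : K) (α : Fin (n + 1) → ℕ) (S : RSYT n τ) (i : Fin n) (f : PolyV K n τ) :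
    PolyV K n τ :=
  opT t i f + ((t - 1) / (spectral q t α S i.succ / spectral q t α S i.castSucc - 1)) • f

/-- `αΦ = (α_2, ..., α_N, α_1 + 1)`. -/
def affine (α : Fin (n + 1) → ℕ) : Fin (n + 1) → ℕ :=
  Fin.snoc (α := fun _ => ℕ) (fun i : Fin n => α i.succ) (α 0 + 1)

/-- `IsMacdonald q t α S M`: `M` is the vector-valued nonsymmetric Macdonald polynomial `M_{α,S}`,
as produced by the Yang-Baxter graph.  The nodes with `α = 0` carry `1 ⊗ S`; the
steps are `s_i` when `α_i < α_{i+1}`, the exchange `S → S^{(j)}` with `j = r_α(i)` when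
`α_i = α_{i+1}` and `c(j,S) - c(j+1,S) ≥ 2`, and the affine step. -/
inductive IsMacdonald (q t : K) : (Fin (n + 1) → ℕ) → RSYT n τ → PolyV K n τ → Prop
  | root (S : RSYT n τ) : IsMacdonald q t (fun _ => 0) S (1 ⊗ₜ basisVec K S)
  | step (α : Fin (n + 1) → ℕ) (S : RSYT n τ) (M : PolyV K n τ) (i : Fin n)
      (hM : IsMacdonald q t α S M) (hα : α i.castSucc < α i.succ) :
      IsMacdonald q t (α ∘ Equiv.swap i.castSucc i.succ) S (ybStep q t α S i M)
  | exchange (α : Fin (n + 1) → ℕ) (S : RSYT n τ) (M : PolyV K n τ) (i j : Fin n)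
      (hM : IsMacdonald q t α S M) (hα : α i.castSucc = α i.succ)
      (hj : j.castSucc = rank α i.castSucc)
      (hc : 2 ≤ S.content j.castSucc - S.content j.succ) :
      IsMacdonald q t α (S.exchange j) (ybStep q t α S i M)
  | affine (α : Fin (n + 1) → ℕ) (S : RSYT n τ) (M : PolyV K n τ)
      (hM : IsMacdonald q t α S M) :
      IsMacdonald q t (affine α) S (mulXLast K n τ (opW q t M))

/-- The `q`-Pochhammer symbol `(z; q)_m`. -/
def qPochhammer (z q : K) (m : ℕ) : K := ∏ l ∈ Finset.range m, (1 - z * q ^ l)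

/-- `k(λ) = ∑ (N - 2i + 1) λ_i`, with `i` running from `1` to `N`. -/
def kStat (lam : Fin (n + 1) → ℕ) : ℤ :=
  ∑ i : Fin (n + 1), (((n + 1 : ℕ) : ℤ) - 2 * (((i : ℕ) : ℤ) + 1) + 1) * (lam i : ℤ)

/-- `q^a t^b ≠ 1` for all integers `a`, `b`, not both zero, with `-N ≤ b ≤ N`. -/
def Generic (N : ℕ) (q t : K) : Prop :=
  ∀ a b : ℤ, -(N : ℤ) ≤ b → b ≤ N → ¬ (a = 0 ∧ b = 0) → q ^ a * t ^ b ≠ 1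

end

end

end VectorMacdonald

open VectorMacdonald

/-!
The norm is computed along the Yang–Baxter graph, as a closed expression `normValue q t α S` for an
arbitrary composition `α`, which at a partition is the asserted product.

Two facts carry the induction. First, all polynomials of the graph are simultaneous eigenvectors of
the Cherednik operators `ξ_i = t⁻¹ 𝐓_i ξ_{i+1} 𝐓_i`, with eigenvalues the entries of the spectral
vector `ζ`. At the roots the `ξ_i` are Jucys–Murphy elements (`xiOp_one_tmul`); along the edges the
relations of the affine Hecke algebra apply (`IsXiEigen.step`, `IsXiEigen.affine`). These relations
are the braid and quadratic relations of the `𝐓_i`, their exchange relations with `𝐰`, and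
`𝐓_i x_i 𝐓_i = t x_{i+1}`. On `V_τ` they are verified after an embedding in the space of all
fillings of the diagram, where each generator is given by one formula; on polynomials they become
identities of rational functions.

Secondly, the `ξ_i` are self-adjoint, so that eigenvectors with different eigenvalues are
orthogonal. For a step `M' = M 𝐓_i + b M` this gives `‖M'‖² = (1 - b)(t + b) ‖M‖²`, which is
`u(ζ_{i+1} / ζ_i) ‖M‖²` (`BF2.norm_step`). For the affine step `M' = x_N (M 𝐰)` the Dunkl operator
sends `M'` to `(1 - q ζ_1) M 𝐰`; since `𝐰*` is the adjoint of `𝐰` and is surjective, the last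
condition of (BF2) gives `‖M'‖² = (1 - q ζ_1) / (1 - q) ‖M‖²` (`BF2.norm_affine`).

The expression `normValue` is a product over the indices and over the pairs of indices `i < j`, whose
factors depend only on the labels (part, content) of the indices. A step exchanges two adjacent
labels and so affects one pair only, and the affine step rotates the labels
(`normValue_comp_swap`, `normValue_exchange`, `normValue_affine`).
-/

namespace VectorMacdonald

/-! ### Tableaux: positions and contents -/

namespace RSYT

variable {n : ℕ} {τ : YoungDiagram}

theorem eq_of_row_col (S : RSYT n τ) {a b : Fin (n + 1)} (hr : S.row a = S.row b)
    (hc : S.col a = S.col b) : a = b :=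
  S.pos.injective (Subtype.ext (Prod.ext hr hc))

theorem exists_entry (S : RSYT n τ) {r c : ℕ} (h : (r, c) ∈ τ) :
    ∃ e, S.row e = r ∧ S.col e = c :=
  ⟨S.pos.symm ⟨(r, c), h⟩, by simp [row], by simp [col]⟩

theorem mem (S : RSYT n τ) (a : Fin (n + 1)) : (S.row a, S.col a) ∈ τ := (S.pos a).2

theorem exists_corner (S : RSYT n τ) {r c : ℕ} {b : Fin (n + 1)} (hr : r ≤ S.row b)
    (hc : c ≤ S.col b) : ∃ e, S.row e = r ∧ S.col e = c :=
  S.exists_entry (τ.up_left_mem hr hc (S.mem b))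

/-- The entries decrease weakly from the north-west to the south-east. -/
theorem le_of_northWest (S : RSYT n τ) {a b : Fin (n + 1)} (hr : S.row a ≤ S.row b)
    (hc : S.col a ≤ S.col b) : b ≤ a := by
  obtain ⟨e, her, hec⟩ := S.exists_corner hr le_rfl
  have h1 : e ≤ a := by
    rcases hc.eq_or_lt with h | h
    · exact (S.eq_of_row_col her (hec.trans h.symm)).le
    · exact (S.row_decreasing a e her.symm (h.trans_eq hec.symm)).le
  have h2 : b ≤ e := by
    rcases hr.eq_or_lt with h | h
    · exact (S.eq_of_row_col (her.trans h).symm hec.symm).le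
    · exact (S.col_decreasing e b hec (her.trans_lt h)).le
  exact h2.trans h1

/-- Two entries of the same content are at least three apart: the two other corners of the
rectangle they span carry distinct intermediate entries. -/
theorem add_three_le_of_content_eq (S : RSYT n τ) {a b : Fin (n + 1)}
    (h : S.content a = S.content b) (hab : a < b) : (a : ℕ) + 3 ≤ b := by
  simp only [content] at h
  have hlt : S.row b < S.row a := by
    by_contra hcon
    exact absurd (S.le_of_northWest (a := a) (b := b) (by omega) (by omega)) (not_le.2 hab)
  obtain ⟨e, her, hec⟩ := S.exists_corner (b := a) (r := S.row b) (c := S.col a) (by omega) le_rfl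
  obtain ⟨f, hfr, hfc⟩ := S.exists_corner (b := a) (r := S.row a) (c := S.col b) le_rfl (by omega)
  have h1 := S.le_of_northWest (a := b) (b := e) (by omega) (by omega)
  have h2 := S.le_of_northWest (a := e) (b := a) (by omega) (by omega)
  have h3 := S.le_of_northWest (a := b) (b := f) (by omega) (by omega)
  have h4 := S.le_of_northWest (a := f) (b := a) (by omega) (by omega)
  have n1 : e ≠ b := by rintro rfl; omega
  have n2 : e ≠ a := by rintro rfl; omega
  have n3 : f ≠ b := by rintro rfl; omega
  have n4 : f ≠ a := by rintro rfl; omega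
  have n5 : e ≠ f := by rintro rfl; omega
  simp only [ne_eq, Fin.ext_iff, Fin.le_def] at *
  omega

theorem content_ne (S : RSYT n τ) {a b : Fin (n + 1)} (hab : a < b) (h : (b : ℕ) ≤ a + 2) :
    S.content a ≠ S.content b := fun hc => by
  have := S.add_three_le_of_content_eq hc hab
  omega

/-- Consecutive entries of one row are adjacent: a box between them would need an entry between. -/
theorem col_eq_of_row_eq (S : RSYT n τ) (i : Fin n) (h : S.row i.castSucc = S.row i.succ) :
    S.col i.castSucc = S.col i.succ + 1 := by
  have hlt : S.col i.succ < S.col i.castSucc := by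
    by_contra hcon
    exact absurd (S.le_of_northWest h.le (not_lt.1 hcon)) (not_le.2 Fin.castSucc_lt_succ)
  obtain ⟨e, her, hec⟩ := S.exists_corner (b := i.castSucc) (c := S.col i.succ + 1) le_rfl (by omega)
  have h1 := S.le_of_northWest (a := i.succ) (b := e) (by omega) (by omega)
  have h2 := S.le_of_northWest (a := e) (b := i.castSucc) (by omega) (by omega)
  have n1 : e ≠ i.succ := by rintro rfl; omega
  have h3 : e = i.castSucc := by
    simp only [ne_eq, Fin.ext_iff, Fin.le_def, Fin.val_succ, Fin.val_castSucc] at *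
    omega
  rw [← h3, hec]

theorem row_eq_of_col_eq (S : RSYT n τ) (i : Fin n) (h : S.col i.castSucc = S.col i.succ) :
    S.row i.castSucc = S.row i.succ + 1 := by
  have hlt : S.row i.succ < S.row i.castSucc := by
    by_contra hcon
    exact absurd (S.le_of_northWest (not_lt.1 hcon) h.le) (not_le.2 Fin.castSucc_lt_succ)
  obtain ⟨e, her, hec⟩ := S.exists_corner (b := i.castSucc) (r := S.row i.succ + 1)
    (c := S.col i.castSucc) (by omega) le_rfl
  have h1 := S.le_of_northWest (a := i.succ) (b := e) (by omega) (by omega)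
  have h2 := S.le_of_northWest (a := e) (b := i.castSucc) (by omega) (by omega)
  have n1 : e ≠ i.succ := by rintro rfl; omega
  have h3 : e = i.castSucc := by
    simp only [ne_eq, Fin.ext_iff, Fin.le_def, Fin.val_succ, Fin.val_castSucc] at *
    omega
  rw [← h3, her]

theorem col_lt_of_row_lt (S : RSYT n τ) (i : Fin n) (h : S.row i.castSucc < S.row i.succ) :
    S.col i.succ < S.col i.castSucc := by
  by_contra hcon
  exact absurd (S.le_of_northWest h.le (not_lt.1 hcon)) (not_le.2 Fin.castSucc_lt_succ)

/-- `i` is never strictly south-east of `i + 1`: the corner of the rectangle they span would need an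
entry strictly between them. -/
theorem col_lt_of_row_gt (S : RSYT n τ) (i : Fin n) (h : S.row i.succ < S.row i.castSucc)
    (hc : S.col i.castSucc ≠ S.col i.succ) : S.col i.castSucc < S.col i.succ := by
  by_contra hcon
  have hlt : S.col i.succ < S.col i.castSucc := by omega
  obtain ⟨e, her, hec⟩ := S.exists_corner (b := i.castSucc) (r := S.row i.succ)
    (c := S.col i.castSucc) (by omega) le_rfl
  have h1 := S.le_of_northWest (a := i.succ) (b := e) (by omega) (by omega)
  have h2 := S.le_of_northWest (a := e) (b := i.castSucc) (by omega) (by omega)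
  have n1 : e ≠ i.succ := by rintro rfl; omega
  have n2 : e ≠ i.castSucc := by rintro rfl; omega
  simp only [ne_eq, Fin.ext_iff, Fin.le_def, Fin.val_succ, Fin.val_castSucc] at *
  omega

/-- `col a + row b < N`: the boxes `(0, 0), ..., (0, col a)` and `(1, 0), ..., (row b, 0)` are
distinct boxes of the diagram. -/
theorem col_add_row_lt (S : RSYT n τ) (a b : Fin (n + 1)) : S.col a + S.row b < n + 1 := by
  -- the `k`-th box of the hook is `(0, k)` for `k ≤ col a` and `(k - col a, 0)` afterwards
  have key : ∀ k : Fin (S.col a + S.row b + 1), ∃ e,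
      S.row e = (k : ℕ) - S.col a ∧ S.col e = min (k : ℕ) (S.col a) - ((k : ℕ) - S.col a) *
        S.col a := by
    intro k
    rcases le_or_gt (k : ℕ) (S.col a) with h | h
    · obtain ⟨e, h1, h2⟩ := S.exists_corner (b := a) (r := 0) (c := k) (Nat.zero_le _) h
      refine ⟨e, ?_, ?_⟩
      · omega
      · rw [h2, Nat.sub_eq_zero_of_le h, min_eq_left h]; simp
    · obtain ⟨e, h1, h2⟩ := S.exists_corner (b := b) (r := (k : ℕ) - S.col a) (c := 0)
        (by omega) (Nat.zero_le _)
      refine ⟨e, h1, ?_⟩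
      rw [h2, min_eq_right h.le, eq_comm, Nat.sub_eq_zero_iff_le]
      exact Nat.le_mul_of_pos_left _ (by omega)
  choose f hf1 hf2 using key
  have hinj : Function.Injective f := by
    intro k l hkl
    have h1 : (k : ℕ) - S.col a = (l : ℕ) - S.col a := by rw [← hf1, ← hf1, hkl]
    have h2 := (hf2 k).symm.trans ((congrArg S.col hkl).trans (hf2 l))
    rcases Nat.eq_zero_or_pos ((k : ℕ) - S.col a) with h0 | h0
    · rw [← h1, h0] at h2
      apply Fin.ext
      omega
    · apply Fin.ext
      omega
  have := Fintype.card_le_of_injective f hinj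
  simp only [Fintype.card_fin] at this
  omega

theorem content_sub_le (S : RSYT n τ) (a b : Fin (n + 1)) : S.content a - S.content b ≤ n := by
  have := S.col_add_row_lt a b
  simp only [content]
  omega

theorem content_last (S : RSYT n τ) : S.content (Fin.last n) = 0 := by
  obtain ⟨e, h1, h2⟩ := S.exists_corner (b := Fin.last n) (Nat.zero_le _) (Nat.zero_le _)
  have h3 := S.le_of_northWest (a := e) (b := Fin.last n) (by omega) (by omega)
  have h4 := Fin.last_le_iff.1 h3
  subst h4
  simp [content, h1, h2]

theorem row_exchange (S : RSYT n τ) (i : Fin n)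
    (h : S.row i.castSucc ≠ S.row i.succ ∧ S.col i.castSucc ≠ S.col i.succ) (a : Fin (n + 1)) :
    (S.exchange i).row a = S.row (Equiv.swap i.castSucc i.succ a) := by
  rw [exchange, dif_pos h]
  rfl

theorem col_exchange (S : RSYT n τ) (i : Fin n)
    (h : S.row i.castSucc ≠ S.row i.succ ∧ S.col i.castSucc ≠ S.col i.succ) (a : Fin (n + 1)) :
    (S.exchange i).col a = S.col (Equiv.swap i.castSucc i.succ a) := by
  rw [exchange, dif_pos h]
  rfl

theorem content_exchange (S : RSYT n τ) (i : Fin n)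
    (h : S.row i.castSucc ≠ S.row i.succ ∧ S.col i.castSucc ≠ S.col i.succ) (a : Fin (n + 1)) :
    (S.exchange i).content a = S.content (Equiv.swap i.castSucc i.succ a) := by
  simp [content, row_exchange _ _ h, col_exchange _ _ h]

theorem row_ne_and_col_ne (S : RSYT n τ) (i : Fin n)
    (h : 2 ≤ S.content i.castSucc - S.content i.succ) :
    S.row i.castSucc ≠ S.row i.succ ∧ S.col i.castSucc ≠ S.col i.succ := by
  simp only [content] at h
  constructor
  · intro hr
    have := S.col_eq_of_row_eq i hr
    omega
  · intro hc
    have := S.row_eq_of_col_eq i hc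
    omega

end RSYT

/-! ### Hecke operators on fillings -/

section Fillings

variable {K : Type*} [Field K] {n : ℕ} {τ : YoungDiagram}

theorem swap_adjacent_comm (i j : Fin n) (hij : (i : ℕ) + 1 < j) :
    Equiv.swap i.castSucc i.succ * Equiv.swap j.castSucc j.succ
      = Equiv.swap j.castSucc j.succ * Equiv.swap i.castSucc i.succ := by
  have e1 : j.castSucc ≠ i.castSucc := by simp [Fin.ext_iff]; omega
  have e2 : j.castSucc ≠ i.succ := by simp [Fin.ext_iff]; omega
  have e3 : j.succ ≠ i.castSucc := by simp [Fin.ext_iff]; omega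
  have e4 : j.succ ≠ i.succ := by simp [Fin.ext_iff]; omega
  apply Equiv.Perm.Disjoint.commute
  intro a
  by_cases h : a = i.castSucc ∨ a = i.succ
  · right
    rcases h with rfl | rfl
    · exact Equiv.swap_apply_of_ne_of_ne e1.symm e3.symm
    · exact Equiv.swap_apply_of_ne_of_ne e2.symm e4.symm
  · left
    push Not at h
    exact Equiv.swap_apply_of_ne_of_ne h.1 h.2

theorem swap_braid {α : Type*} [DecidableEq α] {a b c : α} (hab : a ≠ b) (hbc : b ≠ c)
    (hac : a ≠ c) : Equiv.swap a b * Equiv.swap b c * Equiv.swap a b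
      = Equiv.swap b c * Equiv.swap a b * Equiv.swap b c := by
  rw [Equiv.swap_mul_swap_mul_swap hab hac, Equiv.swap_comm b c, Equiv.swap_comm a b,
    Equiv.swap_mul_swap_mul_swap hbc.symm hac.symm, Equiv.swap_comm]

/-- An arbitrary filling with `1, ..., N`, recorded by the box (row, column) of each entry. -/
abbrev Filling (n : ℕ) : Type := Fin (n + 1) → ℕ × ℕ

/-- The content of an entry of a filling. -/
def Filling.content (F : Filling n) (a : Fin (n + 1)) : ℤ := ((F a).2 : ℤ) - (F a).1

/-- The filling underlying a tableau. -/
def RSYT.filling (S : RSYT n τ) : Filling n := fun a => (S.pos a).1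

theorem RSYT.filling_injective : Function.Injective (RSYT.filling : RSYT n τ → Filling n) := by
  intro S S' h
  ext a : 2
  exact Subtype.ext (congrFun h a)

theorem RSYT.content_filling (S : RSYT n τ) (a : Fin (n + 1)) : S.filling.content a = S.content a :=
  rfl

/-- The diagonal coefficient of a generator between contents `x` and `y`. -/
def diagCoeff (t : K) (x y : ℤ) : K := (t - 1) * t ^ x / (t ^ x - t ^ y)

/-- The off-diagonal coefficient of a generator between contents `x` and `y`. -/
def offCoeff (t : K) (x y : ℤ) : K :=
  if 2 ≤ x - y then 1 else (t * t ^ x - t ^ y) * (t ^ x - t * t ^ y) / (t ^ x - t ^ y) ^ 2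

/-- The operator on the space of all fillings that extends `τ(T_i)` when `a`, `b` are `i`, `i + 1`. -/
noncomputable def fillT (t : K) (a b : Fin (n + 1)) : (Filling n →₀ K) →ₗ[K] (Filling n →₀ K) :=
  Finsupp.linearCombination K fun F =>
    diagCoeff t (F.content a) (F.content b) • Finsupp.single F 1
      + offCoeff t (F.content a) (F.content b) • Finsupp.single (F ∘ Equiv.swap a b) 1

theorem fillT_single (t : K) (a b : Fin (n + 1)) (F : Filling n) :
    fillT t a b (Finsupp.single F 1)
      = diagCoeff t (F.content a) (F.content b) • Finsupp.single F 1
        + offCoeff t (F.content a) (F.content b) • Finsupp.single (F ∘ Equiv.swap a b) 1 := by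
  simp [fillT]

theorem Filling.content_comp (F : Filling n) (s : Fin (n + 1) → Fin (n + 1)) (a : Fin (n + 1)) :
    Filling.content (F ∘ s) a = F.content (s a) := rfl

theorem Filling.comp_swap_comp_swap (F : Filling n) (a b : Fin (n + 1)) :
    F ∘ Equiv.swap a b ∘ Equiv.swap a b = F := by
  funext c
  simp

/-- The inclusion of `V_τ` in the space of all fillings. -/
noncomputable def toFillings (K : Type*) [Field K] (n : ℕ) (τ : YoungDiagram) :
    V K n τ →ₗ[K] (Filling n →₀ K) :=
  Finsupp.lmapDomain K K RSYT.filling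

theorem toFillings_basisVec (S : RSYT n τ) :
    toFillings K n τ (basisVec K S) = Finsupp.single S.filling 1 := by
  simp [toFillings, basisVec]

theorem toFillings_injective : Function.Injective (toFillings K n τ) :=
  Finsupp.mapDomain_injective RSYT.filling_injective

theorem filling_exchange (S : RSYT n τ) (i : Fin n)
    (h : S.row i.castSucc ≠ S.row i.succ ∧ S.col i.castSucc ≠ S.col i.succ) :
    (S.exchange i).filling = S.filling ∘ Equiv.swap i.castSucc i.succ := by
  funext a
  exact Prod.ext (S.row_exchange i h a) (S.col_exchange i h a)

/-- Admissibility of the parameter `t`: its powers separate the contents of a tableau. -/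
def Separates (n : ℕ) (t : K) : Prop := t ≠ 0 ∧ ∀ b : ℤ, b ≠ 0 → |b| ≤ n + 1 → t ^ b ≠ 1

theorem Separates.zpow_ne {t : K} (ht : Separates n t) {x y : ℤ} (h : x ≠ y)
    (hxy : |x - y| ≤ n + 1) : t ^ x ≠ t ^ y := by
  intro he
  apply ht.2 (x - y) (sub_ne_zero.2 h) hxy
  rw [zpow_sub₀ ht.1, he, div_self (zpow_ne_zero _ ht.1)]

theorem Separates.content_ne {t : K} (ht : Separates n t) (S : RSYT n τ) {a b : Fin (n + 1)}
    (h : S.content a ≠ S.content b) : t ^ S.content a ≠ t ^ S.content b := by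
  refine ht.zpow_ne h ?_
  have h1 := S.content_sub_le a b
  have h2 := S.content_sub_le b a
  rw [abs_le]
  omega

/-- On tableaux all four cases of the definition of `τ(T_i)` are given by one formula: the
off-diagonal coefficient vanishes when `i` and `i + 1` are in the same row or column. -/
theorem tauT_basisVec {t : K} (ht : Separates n t) (i : Fin n) (S : RSYT n τ) :
    tauT t i (basisVec K S)
        = diagCoeff t (S.content i.castSucc) (S.content i.succ) • basisVec K S
          + offCoeff t (S.content i.castSucc) (S.content i.succ) • basisVec K (S.exchange i)
      ∧ (offCoeff t (S.content i.castSucc) (S.content i.succ) = 0 ∨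
          (S.row i.castSucc ≠ S.row i.succ ∧ S.col i.castSucc ≠ S.col i.succ)) := by
  have hc : S.content i.castSucc ≠ S.content i.succ :=
    S.content_ne Fin.castSucc_lt_succ (by simp)
  have hne := ht.content_ne S hc
  have hne' := sub_ne_zero.2 hne
  have ht0 := ht.1
  have hx : t ^ S.content i.castSucc ≠ 0 := zpow_ne_zero _ ht0
  have hy : t ^ S.content i.succ ≠ 0 := zpow_ne_zero _ ht0
  have happ : tauT t i (basisVec K S) = tauOnTableau t i S := by simp [tauT, basisVec]
  rw [happ, tauOnTableau]
  split_ifs with h1 h2 h3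
  · have hcol := S.col_eq_of_row_eq i h1
    have hcc : S.content i.castSucc = S.content i.succ + 1 := by
      simp only [RSYT.content]; omega
    have hp : t ^ S.content i.castSucc = t ^ S.content i.succ * t := by
      rw [hcc, zpow_add_one₀ ht0]
    have hoff : offCoeff t (S.content i.castSucc) (S.content i.succ) = 0 := by
      rw [offCoeff, if_neg (by omega), hp]; ring
    have hd : diagCoeff t (S.content i.castSucc) (S.content i.succ) = t := by
      rw [diagCoeff, div_eq_iff hne', hp]; ring
    exact ⟨by rw [hoff, hd]; simp, Or.inl hoff⟩
  · have hrow := S.row_eq_of_col_eq i h2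
    have hcc : S.content i.succ = S.content i.castSucc + 1 := by
      simp only [RSYT.content]; omega
    have hp : t ^ S.content i.succ = t ^ S.content i.castSucc * t := by
      rw [hcc, zpow_add_one₀ ht0]
    have hoff : offCoeff t (S.content i.castSucc) (S.content i.succ) = 0 := by
      rw [offCoeff, if_neg (by omega), hp]; ring
    have hd : diagCoeff t (S.content i.castSucc) (S.content i.succ) = -1 := by
      rw [diagCoeff, div_eq_iff hne', hp]; ring
    exact ⟨by rw [hoff, hd]; simp, Or.inl hoff⟩
  · have hcol := S.col_lt_of_row_lt i h3
    have hcc : 2 ≤ S.content i.castSucc - S.content i.succ := by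
      simp only [RSYT.content]; omega
    refine ⟨?_, Or.inr ⟨h1, h2⟩⟩
    have hd : (t - 1) / (1 - t ^ (S.content i.succ - S.content i.castSucc))
        = diagCoeff t (S.content i.castSucc) (S.content i.succ) := by
      rw [diagCoeff, zpow_sub₀ ht0]
      field_simp
    rw [offCoeff, if_pos hcc, hd, one_smul, add_comm]
  · have hcol := S.col_lt_of_row_gt i (by omega) h2
    have hcc : ¬ 2 ≤ S.content i.castSucc - S.content i.succ := by
      simp only [RSYT.content]; omega
    refine ⟨?_, Or.inr ⟨h1, h2⟩⟩
    have hz : t ^ S.content i.castSucc / t ^ S.content i.succ - 1 ≠ 0 := by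
      rw [sub_ne_zero, Ne, div_eq_one_iff_eq hy]; exact hne
    have hd : t ^ (S.content i.castSucc - S.content i.succ) * (t - 1)
        / (t ^ (S.content i.castSucc - S.content i.succ) - 1)
        = diagCoeff t (S.content i.castSucc) (S.content i.succ) := by
      rw [diagCoeff, zpow_sub₀ ht0]
      field_simp
    have he : t * (t ^ (S.content i.castSucc - S.content i.succ + 1) - 1)
        * (t ^ (S.content i.castSucc - S.content i.succ - 1) - 1)
        / (t ^ (S.content i.castSucc - S.content i.succ) - 1) ^ 2
        = offCoeff t (S.content i.castSucc) (S.content i.succ) := by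
      rw [offCoeff, if_neg hcc, zpow_add_one₀ ht0, zpow_sub_one₀ ht0, zpow_sub₀ ht0]
      field_simp
    rw [hd, he, add_comm]

theorem toFillings_tauT {t : K} (ht : Separates n t) (i : Fin n) (v : V K n τ) :
    toFillings K n τ (tauT t i v) = fillT t i.castSucc i.succ (toFillings K n τ v) := by
  have : toFillings K n τ ∘ₗ tauT t i = fillT t i.castSucc i.succ ∘ₗ toFillings K n τ := by
    apply Finsupp.lhom_ext'
    intro S
    apply LinearMap.ext_ring
    change toFillings K n τ (tauT t i (basisVec K S)) 
      = fillT t i.castSucc i.succ (toFillings K n τ (basisVec K S))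
    obtain ⟨h1, h2⟩ := tauT_basisVec ht i S
    rw [h1, map_add, map_smul, map_smul, toFillings_basisVec, toFillings_basisVec, fillT_single]
    simp only [RSYT.content_filling]
    rcases h2 with h2 | h2
    · simp [h2]
    · rw [filling_exchange S i h2]
  exact LinearMap.congr_fun this v

theorem diagCoeff_add {t : K} {x y : ℤ} (h : t ^ x ≠ t ^ y) :
    diagCoeff t x y + diagCoeff t y x = t - 1 := by
  have h1 := sub_ne_zero.2 h
  have h2 := sub_ne_zero.2 h.symm
  simp only [diagCoeff]
  field_simp
  ring

/-- The product of the off-diagonal coefficients for `(x, y)` and `(y, x)`. -/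
theorem offCoeff_mul {t : K} (ht : t ≠ 0) {x y : ℤ} (h : t ^ x ≠ t ^ y) :
    offCoeff t x y * offCoeff t y x
      = (t * t ^ x - t ^ y) * (t ^ x - t * t ^ y) / (t ^ x - t ^ y) ^ 2 := by
  have h1 := sub_ne_zero.2 h
  have h2 := sub_ne_zero.2 h.symm
  have hsq : (t ^ x - t ^ y) ^ 2 = (t ^ y - t ^ x) ^ 2 := by ring
  have hsymm : (t * t ^ y - t ^ x) * (t ^ y - t * t ^ x)
      = (t * t ^ x - t ^ y) * (t ^ x - t * t ^ y) := by ring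
  simp only [offCoeff]
  rw [← hsq, hsymm]
  by_cases hx : 2 ≤ x - y
  · rw [if_pos hx, if_neg (by omega), one_mul]
  by_cases hy : 2 ≤ y - x
  · rw [if_neg hx, if_pos hy, mul_one]
  rw [if_neg hx, if_neg hy]
  -- the remaining differences are `±1`, where both factors vanish
  have hne : x ≠ y := fun he => h (by rw [he])
  have h0 : (t * t ^ x - t ^ y) * (t ^ x - t * t ^ y) = 0 := by
    rcases (by omega : x = y + 1 ∨ y = x + 1) with rfl | rfl
    · rw [zpow_add_one₀ ht]; ring
    · rw [zpow_add_one₀ ht]; ring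
  rw [h0]; simp

/-- The quadratic relation for two vectors exchanged by a generator. -/
theorem quadratic_aux {W : Type*} [AddCommGroup W] [Module K W] (A : W →ₗ[K] W) {t : K}
    (ht : t ≠ 0) {x y : ℤ} (h : t ^ x ≠ t ^ y) {v v' : W}
    (h1 : A v = diagCoeff t x y • v + offCoeff t x y • v')
    (h2 : A v' = diagCoeff t y x • v' + offCoeff t y x • v) :
    A (A v) = (t - 1) • A v + t • v := by
  have e1 := diagCoeff_add h
  have e2 := offCoeff_mul ht h
  have e3 : diagCoeff t x y ^ 2 + offCoeff t x y * offCoeff t y x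
      = (t - 1) * diagCoeff t x y + t := by
    have h1 := sub_ne_zero.2 h
    rw [e2, diagCoeff]
    field_simp
    ring
  rw [h1]
  simp only [map_add, map_smul, h1, h2]
  match_scalars
  · linear_combination e3
  · linear_combination offCoeff t x y * e1

/-- The braid relation on the six vectors obtained from `v` by permuting three contents: the
coefficients of each vector on the two sides have the same off-diagonal factors, so that only
identities between diagonal coefficients remain. -/
theorem braid_aux {W : Type*} [AddCommGroup W] [Module K W] (A B : W →ₗ[K] W) {t : K}
    (ht : t ≠ 0) {x y z : ℤ} (hxy : t ^ x ≠ t ^ y) (hyz : t ^ y ≠ t ^ z) (hxz : t ^ x ≠ t ^ z)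
    {v v1 v2 v12 v21 v121 : W}
    (a0 : A v = diagCoeff t x y • v + offCoeff t x y • v1)
    (a1 : A v1 = diagCoeff t y x • v1 + offCoeff t y x • v)
    (b0 : B v = diagCoeff t y z • v + offCoeff t y z • v2)
    (b2 : B v2 = diagCoeff t z y • v2 + offCoeff t z y • v)
    (b1 : B v1 = diagCoeff t x z • v1 + offCoeff t x z • v12)
    (a2 : A v2 = diagCoeff t x z • v2 + offCoeff t x z • v21)
    (a12 : A v12 = diagCoeff t y z • v12 + offCoeff t y z • v121)
    (b21 : B v21 = diagCoeff t x y • v21 + offCoeff t x y • v121) :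
    A (B (A v)) = B (A (B v)) := by
  have e1 := offCoeff_mul ht hxy
  have e2 := offCoeff_mul ht hyz
  have n1 := sub_ne_zero.2 hxy
  have n2 := sub_ne_zero.2 hyz
  have n3 := sub_ne_zero.2 hxz
  have n1' := sub_ne_zero.2 hxy.symm
  have n2' := sub_ne_zero.2 hyz.symm
  have c0 : diagCoeff t x y ^ 2 * diagCoeff t y z
        + offCoeff t x y * offCoeff t y x * diagCoeff t x z
      = diagCoeff t y z ^ 2 * diagCoeff t x y
        + offCoeff t y z * offCoeff t z y * diagCoeff t x z := by
    rw [e1, e2]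
    simp only [diagCoeff]
    field_simp
    ring
  have c1 : diagCoeff t x y * diagCoeff t y z + diagCoeff t x z * diagCoeff t y x
      = diagCoeff t y z * diagCoeff t x z := by
    simp only [diagCoeff]
    field_simp
    ring
  have c2 : diagCoeff t x y * diagCoeff t x z
      = diagCoeff t x y * diagCoeff t y z + diagCoeff t z y * diagCoeff t x z := by
    simp only [diagCoeff]
    field_simp
    ring
  simp only [a0, b0, a1, b1, a2, b2, a12, b21, map_add, map_smul]
  match_scalars
  · linear_combination c0
  · linear_combination offCoeff t x y * c1
  · linear_combination offCoeff t y z * c2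
  · ring
  · ring
  · ring

theorem tauT_quadratic {t : K} (ht : Separates n t) (i : Fin n) :
    (tauT t i * tauT t i : Module.End K (V K n τ)) = (t - 1) • tauT t i + t • 1 := by
  apply Finsupp.lhom_ext'
  intro S
  apply LinearMap.ext_ring
  apply toFillings_injective
  change toFillings K n τ (tauT t i (tauT t i (basisVec K S)))
    = toFillings K n τ ((t - 1) • tauT t i (basisVec K S) + t • basisVec K S)
  simp only [map_add, map_smul, toFillings_tauT ht, toFillings_basisVec]
  have hc : S.content i.castSucc ≠ S.content i.succ :=
    S.content_ne Fin.castSucc_lt_succ (by simp)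
  refine quadratic_aux _ ht.1 (ht.content_ne S hc) (fillT_single t _ _ _)
    (v' := Finsupp.single (S.filling ∘ Equiv.swap i.castSucc i.succ) 1) ?_
  simp [fillT_single, Filling.content_comp, RSYT.content_filling, Function.comp_assoc,
    Filling.comp_swap_comp_swap]

theorem tauT_comm {t : K} (ht : Separates n t) (i j : Fin n) (hij : (i : ℕ) + 1 < j) :
    (tauT t i * tauT t j : Module.End K (V K n τ)) = tauT t j * tauT t i := by
  apply Finsupp.lhom_ext'
  intro S
  apply LinearMap.ext_ring
  apply toFillings_injective
  change toFillings K n τ (tauT t i (tauT t j (basisVec K S)))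
    = toFillings K n τ (tauT t j (tauT t i (basisVec K S)))
  simp only [toFillings_tauT ht, toFillings_basisVec]
  have e1 : j.castSucc ≠ i.castSucc := by simp [Fin.ext_iff]; omega
  have e2 : j.castSucc ≠ i.succ := by simp [Fin.ext_iff]; omega
  have e3 : j.succ ≠ i.castSucc := by simp [Fin.ext_iff]; omega
  have e4 : j.succ ≠ i.succ := by simp [Fin.ext_iff]; omega
  have hcomm := swap_adjacent_comm i j hij
  have hcomm' : (S.filling ∘ Equiv.swap i.castSucc i.succ) ∘ Equiv.swap j.castSucc j.succ
      = (S.filling ∘ Equiv.swap j.castSucc j.succ) ∘ Equiv.swap i.castSucc i.succ := by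
    funext a
    exact congrArg S.filling (Equiv.congr_fun hcomm a)
  have f1 : ∀ F : Filling n, (Filling.content (F ∘ Equiv.swap i.castSucc i.succ) j.castSucc
      = F.content j.castSucc) := fun F => by
    simp [Filling.content, Equiv.swap_apply_of_ne_of_ne e1 e2]
  have f2 : ∀ F : Filling n, (Filling.content (F ∘ Equiv.swap i.castSucc i.succ) j.succ
      = F.content j.succ) := fun F => by
    simp [Filling.content, Equiv.swap_apply_of_ne_of_ne e3 e4]
  have f3 : ∀ F : Filling n, (Filling.content (F ∘ Equiv.swap j.castSucc j.succ) i.castSucc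
      = F.content i.castSucc) := fun F => by
    simp [Filling.content, Equiv.swap_apply_of_ne_of_ne e1.symm e3.symm]
  have f4 : ∀ F : Filling n, (Filling.content (F ∘ Equiv.swap j.castSucc j.succ) i.succ
      = F.content i.succ) := fun F => by
    simp [Filling.content, Equiv.swap_apply_of_ne_of_ne e2.symm e4.symm]
  simp only [fillT_single, map_add, map_smul, f1, f2, f3, f4, hcomm']
  module

/-- The braid relation at a filling in which the contents of the three entries are separated. -/
theorem fillT_braid {t : K} (ht : t ≠ 0) {a b c : Fin (n + 1)} (hab : a ≠ b) (hbc : b ≠ c)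
    (hac : a ≠ c) (F : Filling n) (hxy : t ^ F.content a ≠ t ^ F.content b)
    (hyz : t ^ F.content b ≠ t ^ F.content c) (hxz : t ^ F.content a ≠ t ^ F.content c) :
    fillT t a b (fillT t b c (fillT t a b (Finsupp.single F 1)))
      = fillT t b c (fillT t a b (fillT t b c (Finsupp.single F 1))) := by
  have hbr := swap_braid hab hbc hac
  have hbr' : F ∘ Equiv.swap a b ∘ Equiv.swap b c ∘ Equiv.swap a b
      = F ∘ Equiv.swap b c ∘ Equiv.swap a b ∘ Equiv.swap b c := by
    funext d
    exact congrArg F (Equiv.congr_fun hbr d)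
  refine braid_aux _ _ ht hxy hyz hxz (fillT_single t a b F)
    (v1 := Finsupp.single (F ∘ Equiv.swap a b) 1) (v2 := Finsupp.single (F ∘ Equiv.swap b c) 1)
    (v12 := Finsupp.single (F ∘ Equiv.swap a b ∘ Equiv.swap b c) 1)
    (v21 := Finsupp.single (F ∘ Equiv.swap b c ∘ Equiv.swap a b) 1)
    (v121 := Finsupp.single (F ∘ Equiv.swap a b ∘ Equiv.swap b c ∘ Equiv.swap a b) 1)
    ?_ ?_ ?_ ?_ ?_ ?_ ?_
  case refine_7 => rw [hbr']; simp [fillT_single, Filling.content_comp, Function.comp_assoc,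
    Equiv.swap_apply_of_ne_of_ne, hab, hac, hac.symm, hbc.symm]
  all_goals simp [fillT_single, Filling.content_comp, Function.comp_assoc,
    Filling.comp_swap_comp_swap, Equiv.swap_apply_of_ne_of_ne, hab, hac, hac.symm,
    hbc.symm]

/-- The braid relation on `V_τ`. Three consecutive entries of a tableau have distinct contents, so
that no denominator vanishes on the fillings that occur. -/
theorem tauT_braid {t : K} (ht : Separates n t) (i j : Fin n) (hij : (i : ℕ) + 1 = j) :
    (tauT t i * tauT t j * tauT t i : Module.End K (V K n τ))
      = tauT t j * tauT t i * tauT t j := by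
  apply Finsupp.lhom_ext'
  intro S
  apply LinearMap.ext_ring
  apply toFillings_injective
  change toFillings K n τ (tauT t i (tauT t j (tauT t i (basisVec K S))))
    = toFillings K n τ (tauT t j (tauT t i (tauT t j (basisVec K S))))
  simp only [toFillings_tauT ht, toFillings_basisVec]
  have hb : j.castSucc = i.succ := Fin.ext (by simp [← hij])
  have l1 : i.castSucc < i.succ := Fin.castSucc_lt_succ
  have l2 : i.succ < j.succ := by rw [← hb]; exact Fin.castSucc_lt_succ
  rw [hb]
  exact fillT_braid ht.1 l1.ne l2.ne (l1.trans l2).ne S.filling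
    (ht.content_ne S (S.content_ne l1 (by simp)))
    (ht.content_ne S (S.content_ne l2 (by simp; omega)))
    (ht.content_ne S (S.content_ne (l1.trans l2) (by simp; omega)))

end Fillings

/-! ### Products in braid families -/

section Braid

variable {K : Type*} [Field K] {W : Type*} [AddCommGroup W] [Module K W] {n : ℕ}

theorem rightProd_append {ι : Type*} (A : ι → Module.End K W) (l l' : List ι) :
    (rightProd A (l ++ l') : Module.End K W) = rightProd A l' * rightProd A l := by
  induction l with
  | nil => rfl
  | cons i l ih =>
    rw [List.cons_append]
    change rightProd A (l ++ l') * A i = rightProd A l' * (rightProd A l * A i)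
    rw [ih, mul_assoc]

theorem rightProd_map {ι κ : Type*} (A : ι → Module.End K W) (f : κ → ι) (l : List κ) :
    rightProd A (l.map f) = rightProd (fun k => A (f k)) l := by
  induction l with
  | nil => rfl
  | cons i l ih => simp only [List.map_cons, rightProd, ih]

/-- The product that applies `T 0` first and `T (n - 1)` last. -/
def ascProd (T : Fin n → Module.End K W) : Module.End K W := rightProd T (List.finRange n)

/-- The product that applies `T (n - 1)` first and `T 0` last. -/
def descProd (T : Fin n → Module.End K W) : Module.End K W :=
  rightProd T (List.finRange n).reverse

theorem ascProd_zero (T : Fin 0 → Module.End K W) : ascProd T = 1 := rfl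

theorem descProd_zero (T : Fin 0 → Module.End K W) : descProd T = 1 := rfl

theorem ascProd_succ (T : Fin (n + 1) → Module.End K W) :
    ascProd T = ascProd (fun i => T i.succ) * T 0 := by
  rw [ascProd, List.finRange_succ]
  change rightProd T ((List.finRange n).map Fin.succ) * T 0 = _
  rw [rightProd_map]; rfl

theorem ascProd_succ_last (T : Fin (n + 1) → Module.End K W) :
    ascProd T = T (Fin.last n) * ascProd (fun i => T i.castSucc) := by
  rw [ascProd, List.finRange_succ_last, rightProd_append, rightProd_map]
  rfl

theorem descProd_succ_last (T : Fin (n + 1) → Module.End K W) :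
    descProd T = descProd (fun i => T i.castSucc) * T (Fin.last n) := by
  rw [descProd, List.finRange_succ_last, List.reverse_append, rightProd_append, ← List.map_reverse,
    rightProd_map]
  rfl

/-- Sandwiching `x 0` by the generators one after another. -/
theorem ascProd_mul_mul_descProd (T : Fin n → Module.End K W) (x : Fin (n + 1) → Module.End K W)
    (c : K) (h : ∀ i : Fin n, T i * x i.castSucc * T i = c • x i.succ) :
    ascProd T * x 0 * descProd T = c ^ n • x (Fin.last n) := by
  induction n with
  | zero => simp [ascProd_zero, descProd_zero]
  | succ n ih =>
    have := ih (fun i => T i.castSucc) (fun i => x i.castSucc) (fun i => h i.castSucc)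
    rw [ascProd_succ_last, descProd_succ_last]
    calc _ = T (Fin.last n) * (ascProd (fun i => T i.castSucc) * x (Fin.castSucc 0)
            * descProd (fun i => T i.castSucc)) * T (Fin.last n) := by
          simp only [mul_assoc, Fin.castSucc_zero]
      _ = _ := by
          rw [this, mul_smul_comm, smul_mul_assoc, h, smul_smul, pow_succ, Fin.succ_last]

theorem descProd_mul_mul_ascProd (T : Fin n → Module.End K W) (x : Fin (n + 1) → Module.End K W)
    (c : K) (h : ∀ i : Fin n, T i * x i.succ * T i = c • x i.castSucc) :
    descProd T * x (Fin.last n) * ascProd T = c ^ n • x 0 := by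
  induction n with
  | zero => simp [ascProd_zero, descProd_zero]
  | succ n ih =>
    have := ih (fun i => T i.castSucc) (fun i => x i.castSucc) (fun i => h i.castSucc)
    have hl := h (Fin.last n)
    rw [Fin.succ_last] at hl
    rw [ascProd_succ_last, descProd_succ_last]
    calc _ = descProd (fun i => T i.castSucc) * (T (Fin.last n) * x (Fin.last (n + 1))
            * T (Fin.last n)) * ascProd (fun i => T i.castSucc) := by
          simp only [mul_assoc]
      _ = _ := by
          rw [hl, mul_smul_comm, smul_mul_assoc, this, smul_smul, pow_succ', Fin.castSucc_zero]

theorem ascProd_mul_descProd_eq_one (T T' : Fin n → Module.End K W) (h : ∀ i, T i * T' i = 1) :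
    ascProd T * descProd T' = 1 := by
  induction n with
  | zero => simp [ascProd_zero, descProd_zero]
  | succ n ih =>
    have := ih (fun i => T i.castSucc) (fun i => T' i.castSucc) (fun i => h i.castSucc)
    rw [ascProd_succ_last, descProd_succ_last, mul_assoc, ← mul_assoc (ascProd _), this, one_mul, h]

theorem descProd_mul_ascProd_eq_one (T T' : Fin n → Module.End K W) (h : ∀ i, T' i * T i = 1) :
    descProd T' * ascProd T = 1 := by
  induction n with
  | zero => simp [ascProd_zero, descProd_zero]
  | succ n ih =>
    have := ih (fun i => T i.castSucc) (fun i => T' i.castSucc) (fun i => h i.castSucc)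
    rw [ascProd_succ_last, descProd_succ_last, mul_assoc, ← mul_assoc (T' _), h, one_mul, this]

/-- `ascProd` intertwines two families as soon as an operator intertwines their members. -/
theorem ascProd_intertwine (T T' : Fin n → Module.End K W) (w : Module.End K W)
    (h : ∀ i, w * T i = T' i * w) : w * ascProd T = ascProd T' * w := by
  induction n with
  | zero => simp [ascProd_zero]
  | succ n ih =>
    rw [ascProd_succ_last, ascProd_succ_last, ← mul_assoc, h, mul_assoc,
      ih _ _ (fun i => h i.castSucc), mul_assoc]

/-- A family of operators satisfying the braid relations. -/
structure IsBraidFamily (T : Fin n → Module.End K W) : Prop where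
  comm : ∀ i j : Fin n, (i : ℕ) + 1 < j → T i * T j = T j * T i
  braid : ∀ i j : Fin n, (i : ℕ) + 1 = j → T i * T j * T i = T j * T i * T j

namespace IsBraidFamily

theorem castSucc {T : Fin (n + 1) → Module.End K W} (h : IsBraidFamily T) :
    IsBraidFamily (fun i : Fin n => T i.castSucc) :=
  ⟨fun i j hij => h.comm _ _ (by simpa using hij), fun i j hij => h.braid _ _ (by simpa using hij)⟩

/-- The Coxeter element conjugates each generator into the preceding one. -/
theorem ascProd_mul {T : Fin n → Module.End K W} (h : IsBraidFamily T) (i j : Fin n)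
    (hij : (i : ℕ) + 1 = j) : ascProd T * T j = T i * ascProd T := by
  induction n with
  | zero => exact i.elim0
  | succ n ih =>
    rcases Fin.eq_castSucc_or_eq_last j with ⟨j', rfl⟩ | rfl
    · obtain ⟨i', rfl⟩ : ∃ i', i = Fin.castSucc i' :=
        ⟨⟨i, by have := j'.2; simp at hij; omega⟩, rfl⟩
      have := ih h.castSucc i' j' (by simpa using hij)
      rw [ascProd_succ_last, mul_assoc, this, ← mul_assoc, ← mul_assoc,
        h.comm i'.castSucc (Fin.last n) (by have := j'.2; simp at hij ⊢; omega)]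
    · cases n with
      | zero => simp at hij
      | succ n =>
        obtain rfl : i = (Fin.last n).castSucc := Fin.ext (by simpa using hij)
        have hc : ascProd (fun i : Fin n => T i.castSucc.castSucc) * T (Fin.last (n + 1))
            = T (Fin.last (n + 1)) * ascProd (fun i : Fin n => T i.castSucc.castSucc) := by
          refine (ascProd_intertwine _ _ _ fun i => ?_).symm
          exact (h.comm _ _ (by simp)).symm
        rw [ascProd_succ_last, ascProd_succ_last, mul_assoc, mul_assoc, hc, ← mul_assoc, ← mul_assoc,
          ← h.braid _ _ (by simp)]
        simp only [mul_assoc]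

/-- The square of the Coxeter element conjugates the first generator into the last one. -/
theorem ascProd_sq_mul {T : Fin (n + 1) → Module.End K W} (h : IsBraidFamily T) :
    ascProd T * ascProd T * T 0 = T (Fin.last n) * (ascProd T * ascProd T) := by
  have h1 : ascProd T * ascProd (fun i : Fin n => T i.succ)
      = ascProd (fun i : Fin n => T i.castSucc) * ascProd T :=
    ascProd_intertwine _ _ _ fun i => h.ascProd_mul _ _ (by simp)
  calc ascProd T * ascProd T * T 0
      = T (Fin.last n) * (ascProd (fun i => T i.castSucc) * ascProd T) * T 0 := by
        simp only [← mul_assoc, ← ascProd_succ_last]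
    _ = T (Fin.last n) * (ascProd T * (ascProd (fun i : Fin n => T i.succ) * T 0)) := by
        rw [← h1]; simp only [mul_assoc]
    _ = _ := by rw [← ascProd_succ]

end IsBraidFamily

end Braid

section

variable {K : Type*} [Field K] {n : ℕ} {τ : YoungDiagram}

theorem tauT_isBraidFamily {t : K} (ht : Separates n t) :
    IsBraidFamily (fun i => (tauT t i : Module.End K (V K n τ))) :=
  ⟨tauT_comm ht, tauT_braid ht⟩

end

/-! ### Divided differences -/

section Polynomial

open MvPolynomial

variable {K : Type*} [Field K] {n : ℕ}

/-- The part `p ↦ (1 - t) x_{i+1} (p - p s_i) / (x_i - x_{i+1})` of the operator `𝐓_i`. -/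
noncomputable def piOp (t : K) (i : Fin n) : Module.End K (Poly K n) :=
  (1 - t) • (LinearMap.mulLeft K (X i.succ) ∘ₗ divDiff K i)

/-- The exchange of `x_i` and `x_{i+1}` as a linear map. -/
noncomputable def swapOp (K : Type*) [Field K] {n : ℕ} (i : Fin n) : Module.End K (Poly K n) :=
  (swapVars K i).toLinearMap

theorem piOp_apply (t : K) (i : Fin n) (p : Poly K n) :
    piOp t i p = C (1 - t) * (X i.succ * divDiff K i p) := by
  simp [piOp, smul_eq_C_mul]

theorem swapOp_apply (i : Fin n) (p : Poly K n) : swapOp K i p = swapVars K i p := rfl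

theorem swapVars_X (i : Fin n) (k : Fin (n + 1)) :
    swapVars K i (X k) = X (Equiv.swap i.castSucc i.succ k) := by
  simp [swapVars]

theorem swapVars_swapVars (i : Fin n) (p : Poly K n) : swapVars K i (swapVars K i p) = p := by
  have : (swapVars K i).comp (swapVars K i) = AlgHom.id K _ := by
    ext k : 1
    simp [swapVars_X]
  exact DFunLike.congr_fun this p

/-- An algebra homomorphism to a field that separates `x_i` and `x_{i+1}` turns the divided
difference into a quotient. -/
theorem map_divDiff {F : Type*} [Field F] [Algebra K F] (φ : Poly K n →ₐ[K] F) (i : Fin n)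
    (h : φ (X i.castSucc) ≠ φ (X i.succ)) (p : Poly K n) :
    φ (divDiff K i p) = (φ p - φ (swapVars K i p)) / (φ (X i.castSucc) - φ (X i.succ)) := by
  rw [eq_div_iff (sub_ne_zero.2 h), mul_comm, ← map_sub, ← map_mul, mul_divDiff, map_sub]

theorem swapVars_comm (i j : Fin n) (hij : (i : ℕ) + 1 < j) (p : Poly K n) :
    swapVars K i (swapVars K j p) = swapVars K j (swapVars K i p) := by
  have : (swapVars K i).comp (swapVars K j) = (swapVars K j).comp (swapVars K i) := by
    ext k : 1
    simp only [AlgHom.comp_apply, swapVars_X]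
    exact congrArg X (Equiv.congr_fun (swap_adjacent_comm i j hij) k)
  exact DFunLike.congr_fun this p

theorem swapVars_braid (i j : Fin n) (hij : (i : ℕ) + 1 = j) (p : Poly K n) :
    swapVars K i (swapVars K j (swapVars K i p)) = swapVars K j (swapVars K i (swapVars K j p)) := by
  have hb : j.castSucc = i.succ := Fin.ext (by simp [← hij])
  have l1 : i.castSucc < i.succ := Fin.castSucc_lt_succ
  have l2 : i.succ < j.succ := by rw [← hb]; exact Fin.castSucc_lt_succ
  have : ((swapVars K i).comp (swapVars K j)).comp (swapVars K i)
      = ((swapVars K j).comp (swapVars K i)).comp (swapVars K j) := by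
    ext k : 1
    simp only [AlgHom.comp_apply, swapVars_X, hb]
    exact congrArg X (Equiv.congr_fun (swap_braid l1.ne l2.ne (l1.trans l2).ne) k)
  exact DFunLike.congr_fun this p

/-- The canonical embedding of the polynomials in their fraction field. -/
noncomputable def toFrac (K : Type*) [Field K] (n : ℕ) : Poly K n →ₐ[K] FractionRing (Poly K n) :=
  IsScalarTower.toAlgHom K _ _

theorem toFrac_injective : Function.Injective (toFrac K n) :=
  IsFractionRing.injective (Poly K n) (FractionRing (Poly K n))

theorem toFrac_X_ne {a b : Fin (n + 1)} (h : a ≠ b) : toFrac K n (X a) ≠ toFrac K n (X b) :=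
  fun he => h (X_injective (toFrac_injective he))

theorem swapOp_sq (i : Fin n) : swapOp K i * swapOp K i = 1 :=
  LinearMap.ext fun p => swapVars_swapVars i p

/-- The evaluation, in the fraction field, of a divided difference transformed by `σ`. -/
theorem toFrac_map_divDiff (σ : Poly K n →ₐ[K] Poly K n) (i : Fin n) {a b : Fin (n + 1)}
    (ha : σ (X i.castSucc) = X a) (hb : σ (X i.succ) = X b) (hab : a ≠ b) (p : Poly K n) :
    toFrac K n (σ (divDiff K i p)) = (toFrac K n (σ p) - toFrac K n (σ (swapVars K i p)))
      / (toFrac K n (X a) - toFrac K n (X b)) := by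
  have := map_divDiff ((toFrac K n).comp σ) i
    (by simpa [ha, hb] using toFrac_X_ne (K := K) hab) p
  simpa [ha, hb] using this

theorem toFrac_divDiff (i : Fin n) (p : Poly K n) :
    toFrac K n (divDiff K i p) = (toFrac K n p - toFrac K n (swapVars K i p))
      / (toFrac K n (X i.castSucc) - toFrac K n (X i.succ)) :=
  toFrac_map_divDiff (AlgHom.id K _) i rfl rfl Fin.castSucc_lt_succ.ne p

theorem swapVars_divDiff (i : Fin n) (p : Poly K n) :
    swapVars K i (divDiff K i p) = divDiff K i p := by
  apply toFrac_injective
  have hne : i.castSucc ≠ i.succ := Fin.castSucc_lt_succ.ne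
  have h := sub_ne_zero.2 (toFrac_X_ne (K := K) hne)
  have h' := sub_ne_zero.2 (toFrac_X_ne (K := K) hne.symm)
  rw [toFrac_divDiff, toFrac_map_divDiff _ i (a := i.succ) (b := i.castSucc) (by simp [swapVars_X])
    (by simp [swapVars_X]) hne.symm, swapVars_swapVars]
  field_simp
  ring

theorem piOp_sq (t : K) (i : Fin n) : piOp t i * piOp t i = (t - 1) • piOp t i := by
  refine LinearMap.ext fun p => ?_
  apply toFrac_injective
  have hne : i.castSucc ≠ i.succ := Fin.castSucc_lt_succ.ne
  have h := sub_ne_zero.2 (toFrac_X_ne (K := K) hne)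
  simp only [Module.End.mul_apply, LinearMap.smul_apply, piOp_apply, map_mul, toFrac_divDiff,
    swapVars_divDiff, swapVars_X, Equiv.swap_apply_right, smul_eq_C_mul, algHom_C,
    algebraMap_eq]
  field_simp
  simp only [map_sub, map_one]
  ring

theorem piOp_swapOp (t : K) (i : Fin n) :
    piOp t i * swapOp K i + swapOp K i * piOp t i = (t - 1) • swapOp K i - (t - 1) • 1 := by
  refine LinearMap.ext fun p => ?_
  apply toFrac_injective
  have hne : i.castSucc ≠ i.succ := Fin.castSucc_lt_succ.ne
  have h := sub_ne_zero.2 (toFrac_X_ne (K := K) hne)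
  simp only [Module.End.mul_apply, LinearMap.smul_apply, piOp_apply, map_mul, toFrac_divDiff,
    swapVars_divDiff, swapVars_X, Equiv.swap_apply_right, smul_eq_C_mul, algHom_C,
    algebraMap_eq, LinearMap.add_apply, LinearMap.sub_apply, map_add, map_sub, swapOp_apply,
    Module.End.one_apply, swapVars_swapVars]
  field_simp
  ring

theorem piOp_comm (t : K) (i j : Fin n) (hij : (i : ℕ) + 1 < j) :
    piOp t i * piOp t j = piOp t j * piOp t i
      ∧ swapOp K i * piOp t j = piOp t j * swapOp K i
      ∧ piOp t i * swapOp K j = swapOp K j * piOp t i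
      ∧ swapOp K i * swapOp K j = swapOp K j * swapOp K i := by
  have e0 : i.castSucc ≠ i.succ := Fin.castSucc_lt_succ.ne
  have e0' : j.castSucc ≠ j.succ := Fin.castSucc_lt_succ.ne
  have e1 : i.castSucc ≠ j.castSucc := by simp [Fin.ext_iff]; omega
  have e2 : i.succ ≠ j.castSucc := by simp [Fin.ext_iff]; omega
  have e3 : i.castSucc ≠ j.succ := by simp [Fin.ext_iff]; omega
  have e4 : i.succ ≠ j.succ := by simp [Fin.ext_iff]; omega
  have x1 : swapVars K i (X j.castSucc) = X j.castSucc := by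
    rw [swapVars_X, Equiv.swap_apply_of_ne_of_ne e1.symm e2.symm]
  have x2 : swapVars K i (X j.succ) = X j.succ := by
    rw [swapVars_X, Equiv.swap_apply_of_ne_of_ne e3.symm e4.symm]
  have x3 : swapVars K j (X i.castSucc) = X i.castSucc := by
    rw [swapVars_X, Equiv.swap_apply_of_ne_of_ne e1 e3]
  have x4 : swapVars K j (X i.succ) = X i.succ := by
    rw [swapVars_X, Equiv.swap_apply_of_ne_of_ne e2 e4]
  have hs := swapVars_comm (K := K) i j hij
  have d1 := fun p => toFrac_map_divDiff (swapVars K i) j x1 x2 e0' p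
  have d2 := fun p => toFrac_map_divDiff (swapVars K j) i x3 x4 e0 p
  have h := sub_ne_zero.2 (toFrac_X_ne (K := K) e0)
  have h' := sub_ne_zero.2 (toFrac_X_ne (K := K) e0')
  refine ⟨?_, ?_, ?_, ?_⟩ <;> refine LinearMap.ext fun p => ?_ <;> apply toFrac_injective <;>
  simp only [Module.End.mul_apply, piOp_apply, map_mul, toFrac_divDiff, d1, d2, x2, x4, hs,
    algHom_C, algebraMap_eq, swapOp_apply]
  field_simp
  ring

/-- The coefficients of the braid relation of the operators `𝐓_i` with respect to the words in
`τ(T_i)`, `τ(T_{i+1})`. -/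
theorem piOp_braid (t : K) (i j : Fin n) (hij : (i : ℕ) + 1 = j) :
    piOp t i * piOp t j * piOp t i + t • (swapOp K i * piOp t j * swapOp K i)
        = piOp t j * piOp t i * piOp t j + t • (swapOp K j * piOp t i * swapOp K j)
      ∧ piOp t i * piOp t j * swapOp K i + swapOp K i * piOp t j * piOp t i
          + (t - 1) • (swapOp K i * piOp t j * swapOp K i) = piOp t j * swapOp K i * piOp t j
      ∧ piOp t i * swapOp K j * piOp t i = piOp t j * piOp t i * swapOp K j
          + swapOp K j * piOp t i * piOp t j + (t - 1) • (swapOp K j * piOp t i * swapOp K j)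
      ∧ swapOp K i * swapOp K j * piOp t i = piOp t j * swapOp K i * swapOp K j
      ∧ piOp t i * swapOp K j * swapOp K i = swapOp K j * swapOp K i * piOp t j
      ∧ swapOp K i * swapOp K j * swapOp K i = swapOp K j * swapOp K i * swapOp K j := by
  have hb : j.castSucc = i.succ := Fin.ext (by simp [← hij])
  have e0 : i.castSucc ≠ i.succ := Fin.castSucc_lt_succ.ne
  have e1 : i.succ ≠ j.succ := hb ▸ Fin.castSucc_lt_succ.ne
  have e2 : i.castSucc ≠ j.succ := by simp [Fin.ext_iff]; omega
  have x1 : swapVars K i (X i.castSucc) = X i.succ := by simp [swapVars_X]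
  have x2 : swapVars K i (X i.succ) = X i.castSucc := by simp [swapVars_X]
  have x3 : swapVars K i (X j.succ) = X j.succ := by
    rw [swapVars_X, Equiv.swap_apply_of_ne_of_ne e2.symm e1.symm]
  have y1 : swapVars K j (X i.castSucc) = X i.castSucc := by
    rw [swapVars_X, hb, Equiv.swap_apply_of_ne_of_ne e0 e2]
  have y2 : swapVars K j (X i.succ) = X j.succ := by simp [swapVars_X, hb]
  have y3 : swapVars K j (X j.succ) = X i.succ := by simp [swapVars_X, hb]
  have hs := swapVars_braid (K := K) i j hij
  have d0 := fun p => toFrac_divDiff (K := K) i p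
  have d0' := fun p => toFrac_divDiff (K := K) j p
  have d1 := fun p => swapVars_divDiff (K := K) i p
  have d2 := fun p => swapVars_divDiff (K := K) j p
  have d3 := fun p => toFrac_map_divDiff (swapVars K i) j (by rw [hb, x2]) x3 e2 p
  have d4 := fun p => toFrac_map_divDiff (swapVars K j) i y1 y2 e2 p
  have d5 := fun p => toFrac_map_divDiff ((swapVars K i).comp (swapVars K j)) i
    (by rw [AlgHom.comp_apply, y1, x1]) (by rw [AlgHom.comp_apply, y2, x3]) e1 p
  have d6 := fun p => toFrac_map_divDiff ((swapVars K j).comp (swapVars K i)) j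
    (by rw [AlgHom.comp_apply, hb, x2, y1]) (by rw [AlgHom.comp_apply, x3, y3]) e0 p
  simp only [AlgHom.comp_apply] at d5 d6
  have h1 := sub_ne_zero.2 (toFrac_X_ne (K := K) e0)
  have h2 := sub_ne_zero.2 (toFrac_X_ne (K := K) e1)
  have h3 := sub_ne_zero.2 (toFrac_X_ne (K := K) e2)
  refine ⟨?_, ?_, ?_, ?_, ?_, ?_⟩ <;> refine LinearMap.ext fun p => ?_ <;>
    apply toFrac_injective <;>
  simp only [Module.End.mul_apply, LinearMap.add_apply, LinearMap.smul_apply, piOp_apply, map_mul,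
    map_add, map_sub, map_one, smul_eq_C_mul, swapOp_apply, algHom_C, algebraMap_eq,
    x2, x3, y2, y3, d0, d0', d1, d2, d3, d4, d5, d6, hb, swapVars_swapVars, hs]
  all_goals try field_simp
  all_goals try ring

/-- The action of an algebra endomorphism that carries `x_j, x_{j+1}` to multiples of
`x_i, x_{i+1}` and intertwines the exchanges. -/
theorem piOp_intertwine (t : K) (ρ : Poly K n →ₐ[K] Poly K n) (i j : Fin n) {c : K}
    (h1 : ρ (X j.castSucc) = C c * X i.castSucc) (h2 : ρ (X j.succ) = C c * X i.succ)
    (hs : ∀ p, ρ (swapVars K j p) = swapVars K i (ρ p)) :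
    ρ.toLinearMap * piOp t j = piOp t i * ρ.toLinearMap := by
  refine LinearMap.ext fun p => ?_
  have hρ := congrArg ρ (mul_divDiff (K := K) j p)
  have hi := mul_divDiff (K := K) i (ρ p)
  rw [map_mul, map_sub, map_sub, h1, h2, hs, ← hi, ← mul_sub, mul_comm (C c), mul_assoc] at hρ
  have := mul_left_cancel₀ (sub_ne_zero_vars i) hρ
  simp only [Module.End.mul_apply, piOp_apply, AlgHom.toLinearMap_apply, map_mul, h2, ← this,
    algHom_C, algebraMap_eq]
  ring

theorem shift_X_zero (q : K) : shift n q (X 0) = C q * X (Fin.last n) := by simp [shift]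

theorem shift_X_succ (q : K) (i : Fin n) : shift n q (X i.succ) = X i.castSucc := by simp [shift]

theorem swapVars_C (i : Fin n) (c : K) : swapVars K i (C c) = C c := by simp [swapVars]

theorem shift_swapVars (q : K) (i j : Fin n) (hij : (i : ℕ) + 1 = j) (p : Poly K n) :
    shift n q (swapVars K j p) = swapVars K i (shift n q p) := by
  have hb : j.castSucc = i.succ := Fin.ext (by simp [← hij])
  have : (shift n q).comp (swapVars K j) = (swapVars K i).comp (shift n q) := by
    ext k : 1
    simp only [AlgHom.comp_apply, swapVars_X]
    refine Fin.cases ?_ (fun k => ?_) k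
    · have e1 : (0 : Fin (n + 1)) ≠ j.castSucc := by simp [Fin.ext_iff]; omega
      have e2 : (0 : Fin (n + 1)) ≠ j.succ := (Fin.succ_ne_zero _).symm
      have e3 : Fin.last n ≠ i.castSucc := (Fin.castSucc_lt_last i).ne'
      have e4 : Fin.last n ≠ i.succ := by rw [← hb]; exact (Fin.castSucc_lt_last j).ne'
      rw [Equiv.swap_apply_of_ne_of_ne e1 e2, shift_X_zero, map_mul, swapVars_C, swapVars_X,
        Equiv.swap_apply_of_ne_of_ne e3 e4]
    · rw [shift_X_succ, swapVars_X, hb]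
      have h1 : Equiv.swap i.succ j.succ k.succ = (Equiv.swap i j k).succ :=
        ((Fin.succ_injective n).swap_apply i j k)
      have h2 : Equiv.swap i.castSucc i.succ k.castSucc = (Equiv.swap i j k).castSucc := by
        rw [← hb]
        exact ((Fin.castSucc_injective n).swap_apply i j k)
      rw [h1, h2, shift_X_succ]
  exact DFunLike.congr_fun this p

theorem shift_shift_swapVars (q : K) (p : Poly K (n + 1)) :
    shift (n + 1) q (shift (n + 1) q (swapVars K 0 p))
      = swapVars K (Fin.last n) (shift (n + 1) q (shift (n + 1) q p)) := by
  have hC : shift (n + 1) q (C q) = C q := algHom_C _ _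
  have hl : shift (n + 1) q (X (Fin.last (n + 1))) = X (Fin.last n).castSucc := by
    rw [← Fin.succ_last, shift_X_succ]
  have h1 : shift (n + 1) q (X 1) = X 0 := by
    have := shift_X_succ q (0 : Fin (n + 1))
    simpa using this
  have : ((shift (n + 1) q).comp (shift (n + 1) q)).comp (swapVars K 0)
      = (swapVars K (Fin.last n)).comp ((shift (n + 1) q).comp (shift (n + 1) q)) := by
    ext k : 1
    simp only [AlgHom.comp_apply, swapVars_X]
    refine Fin.cases ?_ (fun k => Fin.cases ?_ (fun k => ?_) k) k
    · simp [shift_X_zero, hC, hl, h1, swapVars_X]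
    · simp [shift_X_zero, hC, hl, h1, swapVars_X]
    · rw [Equiv.swap_apply_of_ne_of_ne (by simp [Fin.ext_iff]) (by simp [Fin.ext_iff]),
        shift_X_succ, ← Fin.succ_castSucc, shift_X_succ, swapVars_X,
        Equiv.swap_apply_of_ne_of_ne (by simp [Fin.ext_iff]; omega) (by simp [Fin.ext_iff]; omega)]
  exact DFunLike.congr_fun this p

theorem piOp_mulX_comm (t : K) (i : Fin n) (k : Fin (n + 1)) (h1 : k ≠ i.castSucc)
    (h2 : k ≠ i.succ) :
    piOp t i * LinearMap.mulLeft K (X k) = LinearMap.mulLeft K (X k) * piOp t i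
      ∧ swapOp K i * LinearMap.mulLeft K (X k) = LinearMap.mulLeft K (X k) * swapOp K i := by
  have hs : swapVars K i (X k) = X k := by rw [swapVars_X, Equiv.swap_apply_of_ne_of_ne h1 h2]
  have h := sub_ne_zero.2 (toFrac_X_ne (K := K) (Fin.castSucc_lt_succ (i := i)).ne)
  refine ⟨?_, ?_⟩ <;> refine LinearMap.ext fun p => ?_ <;> apply toFrac_injective <;>
  simp only [Module.End.mul_apply, piOp_apply, map_mul, toFrac_divDiff, hs, swapOp_apply,
    LinearMap.mulLeft_apply]
  field_simp

theorem piOp_mulX_castSucc (t : K) (i : Fin n) :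
    piOp t i * LinearMap.mulLeft K (X i.castSucc)
        = LinearMap.mulLeft K (X i.succ) * (piOp t i + (1 - t) • 1)
      ∧ swapOp K i * LinearMap.mulLeft K (X i.castSucc)
        = LinearMap.mulLeft K (X i.succ) * swapOp K i := by
  have hs : swapVars K i (X i.castSucc) = X i.succ := by simp [swapVars_X]
  have h := sub_ne_zero.2 (toFrac_X_ne (K := K) (Fin.castSucc_lt_succ (i := i)).ne)
  refine ⟨?_, ?_⟩ <;> refine LinearMap.ext fun p => ?_ <;> apply toFrac_injective <;>
  simp only [Module.End.mul_apply, piOp_apply, map_mul, toFrac_divDiff, hs, swapOp_apply,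
    LinearMap.mulLeft_apply, LinearMap.add_apply, LinearMap.smul_apply, smul_eq_C_mul, map_add,
    Module.End.one_apply]
  field_simp
  ring

end Polynomial

/-! ### Relations of the operators on vector-valued polynomials -/

section VectorValued

open MvPolynomial

variable {K : Type*} [Field K] {n : ℕ} {τ : YoungDiagram}

/-- The operator on `P_τ` given by operators on the two tensor factors. -/
noncomputable def boxOp (a : Module.End K (Poly K n)) (b : Module.End K (V K n τ)) :
    Module.End K (PolyV K n τ) := TensorProduct.map a b

theorem boxOp_mul (a a' : Module.End K (Poly K n)) (b b' : Module.End K (V K n τ)) :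
    boxOp a b * boxOp a' b' = boxOp (a * a') (b * b') :=
  (TensorProduct.map_mul a a' b b').symm

theorem boxOp_add_left (a a' : Module.End K (Poly K n)) (b : Module.End K (V K n τ)) :
    boxOp (a + a') b = boxOp a b + boxOp a' b := TensorProduct.map_add_left a a' b

theorem boxOp_add_right (a : Module.End K (Poly K n)) (b b' : Module.End K (V K n τ)) :
    boxOp a (b + b') = boxOp a b + boxOp a b' := TensorProduct.map_add_right a b b'

theorem boxOp_smul_left (c : K) (a : Module.End K (Poly K n)) (b : Module.End K (V K n τ)) :
    boxOp (c • a) b = c • boxOp a b := TensorProduct.map_smul_left c a b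

theorem boxOp_smul_right (c : K) (a : Module.End K (Poly K n)) (b : Module.End K (V K n τ)) :
    boxOp a (c • b) = c • boxOp a b := TensorProduct.map_smul_right c a b

theorem boxOp_one : boxOp (1 : Module.End K (Poly K n)) (1 : Module.End K (V K n τ)) = 1 :=
  TensorProduct.map_one

theorem boxOp_tmul (a : Module.End K (Poly K n)) (b : Module.End K (V K n τ)) (p : Poly K n)
    (v : V K n τ) : boxOp a b (p ⊗ₜ v) = a p ⊗ₜ b v := TensorProduct.map_tmul a b p v

/-- The family of operators `𝐓_i` as endomorphisms. -/
noncomputable def heckeT (τ : YoungDiagram) (t : K) (i : Fin n) : Module.End K (PolyV K n τ) :=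
  opT t i

theorem heckeT_eq (t : K) (i : Fin n) :
    heckeT τ t i = boxOp (piOp t i) 1 + boxOp (swapOp K i) (tauT t i) := by
  rw [piOp, boxOp_smul_left]
  rfl

theorem heckeT_quadratic {t : K} (ht : Separates n t) (i : Fin n) :
    heckeT τ t i * heckeT τ t i = (t - 1) • heckeT τ t i + t • 1 := by
  have h1 := congrArg (boxOp · (tauT t i : Module.End K (V K n τ))) (piOp_swapOp t i)
  simp only [sub_eq_add_neg _ ((t - 1) • (1 : Module.End K (Poly K n))),
    ← neg_smul _ (1 : Module.End K (Poly K n)), boxOp_add_left, boxOp_smul_left] at h1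
  rw [heckeT_eq]
  simp only [add_mul, mul_add, boxOp_mul, mul_one, one_mul, piOp_sq, swapOp_sq, tauT_quadratic ht,
    boxOp_add_right, boxOp_smul_left, boxOp_smul_right, boxOp_one]
  refine LinearMap.ext fun f => ?_
  replace h1 := LinearMap.congr_fun h1 f
  simp only [LinearMap.add_apply, LinearMap.smul_apply] at h1 ⊢
  linear_combination (norm := module) h1

theorem heckeT_isBraidFamily {t : K} (ht : Separates n t) :
    IsBraidFamily (heckeT τ t : Fin n → Module.End K (PolyV K n τ)) := by
  constructor
  · intro i j hij
    obtain ⟨h1, h2, h3, h4⟩ := piOp_comm (K := K) t i j hij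
    have h5 := tauT_comm (τ := τ) ht i j hij
    simp only [heckeT_eq, add_mul, mul_add, boxOp_mul, mul_one, one_mul, h1, h2, h3, h4, h5]
    abel
  · intro i j hij
    obtain ⟨h1, h2, h3, h4, h5, h6⟩ := piOp_braid (K := K) t i j hij
    have b := tauT_braid (τ := τ) ht i j hij
    have k1 := congrArg (boxOp · (1 : Module.End K (V K n τ))) h1
    have k2 := congrArg (boxOp · (tauT t i : Module.End K (V K n τ))) h2
    have k3 := congrArg (boxOp · (tauT t j : Module.End K (V K n τ))) h3
    simp only [boxOp_add_left, boxOp_smul_left] at k1 k2 k3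
    simp only [heckeT_eq, add_mul, mul_add, boxOp_mul, mul_one, one_mul, h4, h5, h6, b,
      tauT_quadratic ht, boxOp_add_right, boxOp_smul_right]
    refine LinearMap.ext fun f => ?_
    replace k1 := LinearMap.congr_fun k1 f
    replace k2 := LinearMap.congr_fun k2 f
    replace k3 := LinearMap.congr_fun k3 f
    simp only [LinearMap.add_apply, LinearMap.smul_apply] at k1 k2 k3 ⊢
    linear_combination (norm := module) k1 + k2 + k3

/-- The inverse `𝐓_i⁻¹` as an endomorphism. -/
noncomputable def heckeTInv (τ : YoungDiagram) (t : K) (i : Fin n) : Module.End K (PolyV K n τ) :=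
  opTInv t i

theorem heckeTInv_eq (t : K) (i : Fin n) :
    heckeTInv τ t i = t⁻¹ • (heckeT τ t i + (1 - t) • 1) := rfl

theorem heckeT_mul_inv {t : K} (ht : Separates n t) (i : Fin n) :
    heckeT τ t i * heckeTInv τ t i = 1 := by
  rw [heckeTInv_eq, mul_smul_comm, mul_add, heckeT_quadratic ht, mul_smul_comm, mul_one,
    inv_smul_eq_iff₀ ht.1]
  module

theorem heckeTInv_mul {t : K} (ht : Separates n t) (i : Fin n) :
    heckeTInv τ t i * heckeT τ t i = 1 := by
  rw [heckeTInv_eq, smul_mul_assoc, add_mul, heckeT_quadratic ht, smul_mul_assoc, one_mul,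
    inv_smul_eq_iff₀ ht.1]
  module

/-- The operator `𝐰` as an endomorphism. -/
noncomputable def wOp (τ : YoungDiagram) (n : ℕ) (q t : K) : Module.End K (PolyV K n τ) := opW q t

theorem wOp_eq (q t : K) :
    wOp τ n q t = boxOp (shift n q).toLinearMap (ascProd fun i => tauT t i) := rfl

/-- Multiplication by `x_k`. -/
noncomputable def xOp (K : Type*) [Field K] {n : ℕ} (τ : YoungDiagram) (k : Fin (n + 1)) :
    Module.End K (PolyV K n τ) := boxOp (LinearMap.mulLeft K (X k)) 1

theorem wOp_mul_heckeT {t : K} (ht : Separates n t) (q : K) (i j : Fin n)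
    (hij : (i : ℕ) + 1 = j) : wOp τ n q t * heckeT τ t j = heckeT τ t i * wOp τ n q t := by
  have hb : j.castSucc = i.succ := Fin.ext (by simp [← hij])
  have h1 : (shift n q).toLinearMap * piOp t j = piOp t i * (shift n q).toLinearMap :=
    piOp_intertwine t (shift n q) i j (c := 1) (by rw [hb, shift_X_succ]; simp)
      (by rw [shift_X_succ, hb]; simp) (shift_swapVars q i j hij)
  have h2 : (shift n q).toLinearMap * swapOp K j = swapOp K i * (shift n q).toLinearMap :=
    LinearMap.ext (shift_swapVars q i j hij)
  rw [wOp_eq, heckeT_eq, heckeT_eq, mul_add, add_mul, boxOp_mul, boxOp_mul, boxOp_mul, boxOp_mul,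
    h1, h2, mul_one, one_mul, (tauT_isBraidFamily ht).ascProd_mul i j hij]

/-- `𝐰²` conjugates the first generator into the last one. -/
theorem wOp_sq_mul_heckeT {t : K} (ht : Separates (n + 1) t) (q : K) :
    wOp τ (n + 1) q t * wOp τ (n + 1) q t * heckeT τ t 0
      = heckeT τ t (Fin.last n) * (wOp τ (n + 1) q t * wOp τ (n + 1) q t) := by
  have hC : shift (n + 1) q (C q) = C q := algHom_C _ _
  have hl : shift (n + 1) q (X (Fin.last (n + 1))) = X (Fin.last n).castSucc := by
    rw [← Fin.succ_last, shift_X_succ]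
  have hX1 : shift (n + 1) q (X 1) = X 0 := by
    have := shift_X_succ q (0 : Fin (n + 1))
    simpa using this
  have h1 : ((shift (n + 1) q).comp (shift (n + 1) q)).toLinearMap * piOp t 0
      = piOp t (Fin.last n) * ((shift (n + 1) q).comp (shift (n + 1) q)).toLinearMap :=
    piOp_intertwine t _ _ _ (c := q) (by simp [shift_X_zero, hC, hl])
      (by simp [shift_X_zero, hX1]) (shift_shift_swapVars q)
  have h2 : ((shift (n + 1) q).comp (shift (n + 1) q)).toLinearMap * swapOp K 0
      = swapOp K (Fin.last n) * ((shift (n + 1) q).comp (shift (n + 1) q)).toLinearMap :=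
    LinearMap.ext (shift_shift_swapVars q)
  have h3 : (shift (n + 1) q).toLinearMap * (shift (n + 1) q).toLinearMap
      = ((shift (n + 1) q).comp (shift (n + 1) q)).toLinearMap := rfl
  rw [wOp_eq, boxOp_mul, h3, heckeT_eq, heckeT_eq, mul_add, add_mul, boxOp_mul, boxOp_mul,
    boxOp_mul, boxOp_mul, h1, h2, mul_one, one_mul, (tauT_isBraidFamily ht).ascProd_sq_mul]

theorem heckeT_mul_xOp (t : K) (i : Fin n) (k : Fin (n + 1)) (h1 : k ≠ i.castSucc)
    (h2 : k ≠ i.succ) : heckeT τ t i * xOp K τ k = xOp K τ k * heckeT τ t i := by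
  obtain ⟨e1, e2⟩ := piOp_mulX_comm t i k h1 h2
  simp only [heckeT_eq, xOp, add_mul, mul_add, boxOp_mul, e1, e2, mul_one, one_mul]

theorem heckeT_mul_xOp_mul {t : K} (ht : Separates n t) (i : Fin n) :
    heckeT τ t i * xOp K τ i.castSucc * heckeT τ t i = t • xOp K τ i.succ := by
  obtain ⟨e1, e2⟩ := piOp_mulX_castSucc (K := K) t i
  have h : heckeT τ t i * xOp K τ i.castSucc
      = xOp K τ i.succ * (heckeT τ t i + (1 - t) • 1) := by
    simp only [heckeT_eq, xOp, add_mul, mul_add, boxOp_mul, e1, e2, mul_one, one_mul,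
      boxOp_add_left, mul_smul_comm, boxOp_smul_left]
    abel
  rw [h, mul_assoc, add_mul, heckeT_quadratic ht, smul_mul_assoc, one_mul, ← mul_one (xOp K τ i.succ),
    ← mul_smul_comm, mul_assoc, one_mul]
  congr 1
  module

theorem wOp_mul_xOp_succ (q t : K) (i : Fin n) :
    wOp τ n q t * xOp K τ i.succ = xOp K τ i.castSucc * wOp τ n q t := by
  rw [wOp_eq, xOp, xOp, boxOp_mul, boxOp_mul, mul_one, one_mul]
  congr 1
  refine LinearMap.ext fun p => ?_
  simp [shift_X_succ]

theorem wOp_mul_xOp_zero (q t : K) :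
    wOp τ n q t * xOp K τ 0 = q • (xOp K τ (Fin.last n) * wOp τ n q t) := by
  rw [wOp_eq, xOp, xOp, boxOp_mul, boxOp_mul, mul_one, one_mul, ← boxOp_smul_left]
  congr 1
  refine LinearMap.ext fun p => ?_
  simp [shift_X_zero, smul_eq_C_mul, mul_assoc]

theorem shift_surjective {q : K} (hq : q ≠ 0) : Function.Surjective (shift n q) := by
  let σ : Poly K n →ₐ[K] Poly K n := aeval
    (Fin.lastCases (C q⁻¹ * X 0) (fun i : Fin n => X i.succ))
  have : (shift n q).comp σ = AlgHom.id K _ := by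
    ext k : 1
    refine Fin.lastCases ?_ (fun k => ?_) k
    · simp only [AlgHom.comp_apply, σ, aeval_X, Fin.lastCases_last, map_mul, shift_X_zero, algHom_C,
        algebraMap_eq, ← mul_assoc, AlgHom.id_apply]
      rw [← C_mul, inv_mul_cancel₀ hq, C_1, one_mul]
    · simp [σ, shift_X_succ]
  intro p
  exact ⟨σ p, DFunLike.congr_fun this p⟩

theorem tauOmega_surjective {t : K} (ht : Separates n t) :
    Function.Surjective (tauOmega t : V K n τ →ₗ[K] V K n τ) := by
  have h := ascProd_mul_descProd_eq_one (fun i => (tauT t i : Module.End K (V K n τ)))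
    (fun i => t⁻¹ • (tauT t i + (1 - t) • 1)) (fun i => by
      rw [mul_smul_comm, mul_add, tauT_quadratic ht, mul_smul_comm, mul_one,
        inv_smul_eq_iff₀ ht.1]
      module)
  exact fun v => ⟨_, LinearMap.congr_fun h v⟩

theorem wOp_surjective {q t : K} (hq : q ≠ 0) (ht : Separates n t) :
    Function.Surjective (wOp τ n q t) :=
  TensorProduct.map_surjective (shift_surjective hq) (tauOmega_surjective ht)

theorem opXiLast_eq (q t : K) : (opXiLast q t : Module.End K (PolyV K n τ))
    = wOp τ n q t * descProd (heckeTInv τ t) := rfl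

theorem opXiLast_mul_ascProd {t : K} (ht : Separates n t) (q : K) :
    opXiLast q t * ascProd (heckeT τ t) = wOp τ n q t := by
  rw [opXiLast_eq, mul_assoc, descProd_mul_ascProd_eq_one _ _ (heckeTInv_mul ht), mul_one]

theorem opWStar_surjective {q t : K} (hq : q ≠ 0) (ht : Separates n t) :
    Function.Surjective (opWStar q t : PolyV K n τ →ₗ[K] PolyV K n τ) := by
  have h1 : Function.Surjective (descProd (heckeT τ t)) := fun v =>
    ⟨_, LinearMap.congr_fun (descProd_mul_ascProd_eq_one (heckeTInv τ t) (heckeT τ t)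
      (heckeT_mul_inv ht)) v⟩
  have h2 : Function.Surjective (descProd (heckeTInv τ t)) := fun v =>
    ⟨_, LinearMap.congr_fun (descProd_mul_ascProd_eq_one (heckeT τ t) (heckeTInv τ t)
      (heckeTInv_mul ht)) v⟩
  exact h1.comp ((wOp_surjective hq ht).comp h2)

/-! ### The Cherednik operators -/

/-- The Cherednik operators, defined downwards from `ξ_N` by `ξ_i = t⁻¹ 𝐓_i ξ_{i+1} 𝐓_i`. -/
noncomputable def xiOp (τ : YoungDiagram) (q t : K) (k : Fin (n + 1)) :
    Module.End K (PolyV K n τ) :=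
  Fin.reverseInduction (motive := fun _ => Module.End K (PolyV K n τ)) (opXiLast q t)
    (fun i x => t⁻¹ • (heckeT τ t i * x * heckeT τ t i)) k

theorem xiOp_last (q t : K) : xiOp τ q t (Fin.last n) = opXiLast q t := by
  simp [xiOp]

theorem xiOp_castSucc (q t : K) (i : Fin n) :
    xiOp τ q t i.castSucc = t⁻¹ • (heckeT τ t i * xiOp τ q t i.succ * heckeT τ t i) := by
  simp [xiOp]

theorem smul_xiOp_castSucc {t : K} (ht : t ≠ 0) (q : K) (i : Fin n) :
    heckeT τ t i * xiOp τ q t i.succ * heckeT τ t i = t • xiOp τ q t i.castSucc := by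
  rw [xiOp_castSucc, smul_inv_smul₀ ht]

/-- `𝐓_i` commutes with `ξ_k` for `k > i + 1`. -/
theorem heckeT_mul_xiOp_of_gt {t : K} (ht : Separates n t) (q : K) (i : Fin n) (k : Fin (n + 1))
    (hk : i.succ < k) : heckeT τ t i * xiOp τ q t k = xiOp τ q t k * heckeT τ t i := by
  induction k using Fin.reverseInduction with
  | last =>
    have hi : (i : ℕ) + 1 < n := by simpa [Fin.lt_def] using hk
    have h1 := (heckeT_isBraidFamily (τ := τ) ht).ascProd_mul i ⟨i + 1, hi⟩ rfl
    have h2 := wOp_mul_heckeT (τ := τ) ht q i ⟨i + 1, hi⟩ rfl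
    rw [xiOp_last, opXiLast_eq, ← mul_assoc, ← h2, mul_assoc, mul_assoc]
    congr 1
    have e1 := ascProd_mul_descProd_eq_one (heckeT τ t) (heckeTInv τ t) (heckeT_mul_inv ht)
    have e2 := descProd_mul_ascProd_eq_one (heckeT τ t) (heckeTInv τ t) (heckeTInv_mul ht)
    calc _ = descProd (heckeTInv τ t) * (ascProd (heckeT τ t) * heckeT τ t ⟨i + 1, hi⟩)
          * descProd (heckeTInv τ t) := by rw [← mul_assoc (descProd _), e2, one_mul]
      _ = _ := by rw [h1, mul_assoc, mul_assoc (heckeT τ t i), e1, mul_one]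
  | cast k ih =>
    have hlt : (i : ℕ) + 1 < k := by simpa [Fin.lt_def] using hk
    have h1 := (heckeT_isBraidFamily (τ := τ) ht).comm i k hlt
    have h2 := ih (Fin.lt_def.2 (by simp; omega))
    rw [xiOp_castSucc, mul_smul_comm, smul_mul_assoc]
    congr 1
    calc _ = (heckeT τ t i * heckeT τ t k) * xiOp τ q t k.succ * heckeT τ t k := by
          simp only [mul_assoc]
      _ = heckeT τ t k * (heckeT τ t i * xiOp τ q t k.succ) * heckeT τ t k := by
          rw [h1]; simp only [mul_assoc]
      _ = heckeT τ t k * xiOp τ q t k.succ * (heckeT τ t i * heckeT τ t k) := by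
          rw [h2]; simp only [mul_assoc]
      _ = _ := by rw [h1]; simp only [mul_assoc]

/-- `𝐓_i` commutes with `ξ_k` for `k < i`; the braid relation enters at `k = i - 1`. -/
theorem heckeT_mul_xiOp_of_lt {t : K} (ht : Separates n t) (q : K) (i : Fin n) (k : Fin (n + 1))
    (hk : k < i.castSucc) : heckeT τ t i * xiOp τ q t k = xiOp τ q t k * heckeT τ t i := by
  induction k using Fin.reverseInduction with
  | last => exact absurd hk (not_lt.2 (Fin.le_last _))
  | cast k ih =>
    have hlt : (k : ℕ) < i := hk
    by_cases hki : (k : ℕ) + 1 = i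
    · have hb := (heckeT_isBraidFamily (τ := τ) ht).braid k i hki
      have hc := heckeT_mul_xiOp_of_gt (τ := τ) ht q k i.succ (Fin.lt_def.2 (by simp; omega))
      have hs : k.succ = i.castSucc := Fin.ext (by simp [hki])
      rw [xiOp_castSucc, hs, xiOp_castSucc]
      simp only [mul_smul_comm, smul_mul_assoc]
      congr 2
      generalize heckeT τ t i = A at *
      generalize heckeT τ t k = B at *
      generalize xiOp τ q t i.succ = Y at *
      calc A * (B * (A * Y * A) * B) = A * B * A * Y * A * B := by simp only [mul_assoc]
        _ = B * A * (B * Y) * A * B := by rw [← hb]; simp only [mul_assoc]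
        _ = B * A * Y * (B * A * B) := by rw [hc]; simp only [mul_assoc]
        _ = _ := by rw [hb]; simp only [mul_assoc]
    · have h1 := (heckeT_isBraidFamily (τ := τ) ht).comm k i (by omega)
      have h2 := ih (Fin.lt_def.2 (by simp; omega))
      rw [xiOp_castSucc, mul_smul_comm, smul_mul_assoc]
      congr 1
      calc _ = (heckeT τ t i * heckeT τ t k) * xiOp τ q t k.succ * heckeT τ t k := by
            simp only [mul_assoc]
        _ = heckeT τ t k * (heckeT τ t i * xiOp τ q t k.succ) * heckeT τ t k := by
            rw [← h1]; simp only [mul_assoc]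
        _ = heckeT τ t k * xiOp τ q t k.succ * (heckeT τ t i * heckeT τ t k) := by
            rw [h2]; simp only [mul_assoc]
        _ = _ := by rw [← h1]; simp only [mul_assoc]

theorem heckeT_mul_xiOp {t : K} (ht : Separates n t) (q : K) (i : Fin n) (k : Fin (n + 1))
    (h1 : k ≠ i.castSucc) (h2 : k ≠ i.succ) :
    heckeT τ t i * xiOp τ q t k = xiOp τ q t k * heckeT τ t i := by
  rcases lt_or_gt_of_ne h1 with h | h
  · exact heckeT_mul_xiOp_of_lt ht q i k h
  · refine heckeT_mul_xiOp_of_gt ht q i k ?_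
    simp only [ne_eq, Fin.ext_iff, Fin.lt_def, Fin.val_succ, Fin.val_castSucc] at *
    omega

/-- The affine step `f ↦ x_N (f 𝐰)`. -/
noncomputable def affineOp (τ : YoungDiagram) (n : ℕ) (q t : K) : Module.End K (PolyV K n τ) :=
  xOp K τ (Fin.last n) * wOp τ n q t

theorem heckeT_mul_affineOp {t : K} (ht : Separates n t) (q : K) (i j : Fin n)
    (hij : (i : ℕ) + 1 = j) :
    affineOp τ n q t * heckeT τ t j = heckeT τ t i * affineOp τ n q t := by
  have hl : Fin.last n ≠ i.castSucc := (Fin.castSucc_lt_last i).ne'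
  have hl' : Fin.last n ≠ i.succ := by
    have := j.2
    simp [Fin.ext_iff]; omega
  rw [affineOp, mul_assoc, wOp_mul_heckeT ht q i j hij, ← mul_assoc, ← mul_assoc,
    heckeT_mul_xOp t i _ hl hl']

/-- The affine step intertwines `q ξ_1` with `ξ_N`. -/
theorem xiOp_last_mul_affineOp {t : K} (ht : Separates n t) (q : K) :
    xiOp τ q t (Fin.last n) * affineOp τ n q t
      = q • (affineOp τ n q t * xiOp τ q t 0) := by
  have h1 := ascProd_mul_mul_descProd (heckeT (n := n) τ t) (xOp K τ) t (heckeT_mul_xOp_mul ht)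
  have h2 := descProd_mul_mul_ascProd (heckeT (n := n) τ t) (xiOp τ q t) t (smul_xiOp_castSucc ht.1 q)
  have e2 := descProd_mul_ascProd_eq_one (heckeT (n := n) τ t) (heckeTInv τ t) (heckeTInv_mul ht)
  have htn : t ^ n ≠ 0 := pow_ne_zero _ ht.1
  rw [xiOp_last, mul_assoc, opXiLast_mul_ascProd ht] at h2
  have h3 : descProd (heckeTInv τ t) * (t ^ n • xOp K τ (Fin.last n))
      = xOp K τ 0 * descProd (heckeT τ t) := by
    rw [← h1, ← mul_assoc, ← mul_assoc, e2, one_mul]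
  have h4 : t ^ n • (xiOp τ q t (Fin.last n) * affineOp τ n q t)
      = t ^ n • (q • (affineOp τ n q t * xiOp τ q t 0)) := by
    rw [smul_comm, ← mul_smul_comm (t ^ n) (affineOp τ n q t), ← h2, xiOp_last, opXiLast_eq,
      affineOp]
    calc _ = wOp τ n q t * (descProd (heckeTInv τ t) * (t ^ n • xOp K τ (Fin.last n)))
          * wOp τ n q t := by simp only [mul_assoc, mul_smul_comm, smul_mul_assoc]
      _ = (wOp τ n q t * xOp K τ 0) * (descProd (heckeT τ t) * wOp τ n q t) := by
          rw [h3]; simp only [mul_assoc]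
      _ = _ := by rw [wOp_mul_xOp_zero]; simp only [mul_assoc, smul_mul_assoc]
  exact smul_right_injective _ htn h4

/-- The case of `xiOp_mul_affineOp` from which the others follow by conjugation. -/
theorem xiOp_mul_affineOp_last {t : K} (ht : Separates (n + 1) t) (q : K) :
    xiOp τ q t (Fin.last n).castSucc * affineOp τ (n + 1) q t
      = affineOp τ (n + 1) q t * xiOp τ q t (Fin.last (n + 1)) := by
  set w := wOp τ (n + 1) q t with hw
  set T := (heckeT τ t : Fin (n + 1) → Module.End K (PolyV K (n + 1) τ)) with hT
  set Ti := (heckeTInv τ t : Fin (n + 1) → Module.End K (PolyV K (n + 1) τ)) with hTi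
  set x := xOp K τ (Fin.last (n + 1)) with hx
  set A' := ascProd (fun i : Fin n => T i.castSucc) with hA'
  set D' := descProd (fun i : Fin n => Ti i.castSucc) with hD'
  have eT : ∀ i, T i * Ti i = 1 := heckeT_mul_inv ht
  have eT' : ∀ i, Ti i * T i = 1 := heckeTInv_mul ht
  have e1 : D' * A' = 1 := descProd_mul_ascProd_eq_one _ _ fun i => eT' _
  have e2 : ascProd T * descProd Ti = 1 := ascProd_mul_descProd_eq_one _ _ eT
  have hxA : A' * x = x * A' := by
    have h : ∀ i : Fin n, x * T i.castSucc = T i.castSucc * x := fun i =>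
      (heckeT_mul_xOp (K := K) (τ := τ) t i.castSucc (Fin.last (n + 1)) (by simp [Fin.ext_iff]; omega)
        (by simp [Fin.ext_iff]; omega)).symm
    exact (ascProd_intertwine _ _ _ h).symm
  have hwA : w * ascProd (fun i : Fin n => T i.succ) = A' * w :=
    ascProd_intertwine _ _ _ fun i => wOp_mul_heckeT ht q _ _ (by simp)
  have hxi : xiOp τ q t (Fin.last n).castSucc = t⁻¹ • (T (Fin.last n) * w * D') := by
    rw [xiOp_castSucc, Fin.succ_last, xiOp_last, opXiLast_eq, ← hT, ← hw, ← hTi,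
      descProd_succ_last]
    simp only [mul_assoc, eT', mul_one, hD']
  -- multiplied by the Coxeter element on the right, both sides lose their inverses
  have key : T (Fin.last n) * w * D' * (x * w) * ascProd T = t • (x * w * w) := by
    calc _ = T (Fin.last n) * w * D' * x * (w * ascProd (fun i : Fin n => T i.succ)) * T 0 := by
          rw [ascProd_succ]; simp only [mul_assoc]
      _ = T (Fin.last n) * w * (D' * (x * A')) * w * T 0 := by rw [hwA]; simp only [mul_assoc]
      _ = T (Fin.last n) * (w * x) * w * T 0 := by
          rw [← hxA, ← mul_assoc D', e1, one_mul]; simp only [mul_assoc]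
      _ = T (Fin.last n) * xOp K τ (Fin.last n).castSucc * (w * w * T 0) := by
          rw [hx, ← Fin.succ_last, hw, wOp_mul_xOp_succ]; simp only [mul_assoc]
      _ = T (Fin.last n) * xOp K τ (Fin.last n).castSucc * T (Fin.last n) * (w * w) := by
          rw [hw, hT, wOp_sq_mul_heckeT ht]; simp only [mul_assoc]
      _ = _ := by
          rw [hT, heckeT_mul_xOp_mul ht, hx, Fin.succ_last]; simp only [mul_assoc, smul_mul_assoc]
  have key' : T (Fin.last n) * w * D' * (x * w) = t • (x * w * w * descProd Ti) := by
    rw [← smul_mul_assoc, ← key, mul_assoc _ (ascProd T), e2, mul_one]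
  rw [hxi, xiOp_last, opXiLast_eq, affineOp, ← hw, ← hx, smul_mul_assoc, key',
    inv_smul_smul₀ ht.1, ← hTi]
  simp only [mul_assoc]

/-- The affine step intertwines `ξ_{i+1}` with `ξ_i`. -/
theorem xiOp_mul_affineOp {t : K} (ht : Separates n t) (q : K) (i : Fin n) :
    xiOp τ q t i.castSucc * affineOp τ n q t = affineOp τ n q t * xiOp τ q t i.succ := by
  cases n with
  | zero => exact i.elim0
  | succ n =>
    induction i using Fin.reverseInduction with
    | last => rw [xiOp_mul_affineOp_last ht, Fin.succ_last]
    | cast i ih =>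
      have h := heckeT_mul_affineOp (τ := τ) ht q i.castSucc i.succ (by simp)
      have hs : xiOp τ q t i.castSucc.succ
          = t⁻¹ • (heckeT τ t i.succ * xiOp τ q t i.succ.succ * heckeT τ t i.succ) :=
        xiOp_castSucc q t i.succ
      rw [xiOp_castSucc q t i.castSucc]
      conv_rhs => rw [hs]
      rw [← Fin.succ_castSucc] at ih
      rw [smul_mul_assoc, mul_smul_comm]
      congr 1
      calc _ = heckeT τ t i.castSucc * xiOp τ q t i.castSucc.succ
            * (heckeT τ t i.castSucc * affineOp τ (n + 1) q t) := by simp only [mul_assoc]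
        _ = heckeT τ t i.castSucc * (xiOp τ q t i.castSucc.succ * affineOp τ (n + 1) q t)
            * heckeT τ t i.succ := by rw [← h]; simp only [mul_assoc]
        _ = (heckeT τ t i.castSucc * affineOp τ (n + 1) q t) * xiOp τ q t i.succ.succ
            * heckeT τ t i.succ := by rw [ih]; simp only [mul_assoc]
        _ = _ := by rw [← h]; simp only [mul_assoc]

end VectorValued

/-! ### Ranks -/

section Rank

variable {n : ℕ}

/-- The strict order of the indices, by decreasing parts and then by increasing position, of which
`rank α` is the position function. -/
def Precedes (α : Fin (n + 1) → ℕ) (j i : Fin (n + 1)) : Prop :=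
  α i < α j ∨ (α j = α i ∧ j < i)

open Classical in
theorem rank_val (α : Fin (n + 1) → ℕ) (i : Fin (n + 1)) :
    (rank α i : ℕ) = (Finset.univ.filter (fun j => Precedes α j i)).card := by
  change _ + _ = _
  rw [← Finset.card_union_of_disjoint]
  · congr 1
    ext j
    simp only [Finset.mem_union, Finset.mem_filter, Finset.mem_univ, true_and]
    simp only [Precedes, and_comm]
  · rw [Finset.disjoint_left]
    intro j h1 h2
    simp only [Finset.mem_filter, Finset.mem_univ, true_and] at h1 h2
    omega

theorem rank_lt_rank {α : Fin (n + 1) → ℕ} {j i : Fin (n + 1)} (h : Precedes α j i) :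
    rank α j < rank α i := by
  classical
  rw [Fin.lt_def, rank_val, rank_val]
  apply Finset.card_lt_card
  rw [Finset.ssubset_iff_of_subset]
  · refine ⟨j, by simpa using h, ?_⟩
    simp only [Finset.mem_filter, Finset.mem_univ, true_and]
    simp [Precedes]
  · intro k hk
    simp only [Finset.mem_filter, Finset.mem_univ, true_and] at *
    simp only [Precedes] at *
    omega

theorem rank_injective (α : Fin (n + 1) → ℕ) : Function.Injective (rank α) := by
  intro i j h
  by_contra hne
  rcases lt_trichotomy (α i) (α j) with h1 | h1 | h1
  · exact (rank_lt_rank (Or.inl h1 : Precedes α j i)).ne h.symm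
  · rcases lt_or_gt_of_ne hne with h2 | h2
    · exact (rank_lt_rank (Or.inr ⟨h1, h2⟩ : Precedes α i j)).ne h
    · exact (rank_lt_rank (Or.inr ⟨h1.symm, h2⟩ : Precedes α j i)).ne h.symm
  · exact (rank_lt_rank (Or.inl h1 : Precedes α i j)).ne h

theorem rank_equiv {α β : Fin (n + 1) → ℕ} (σ : Equiv.Perm (Fin (n + 1)))
    (h : ∀ j k, Precedes β j k ↔ Precedes α (σ j) (σ k)) (k : Fin (n + 1)) :
    rank β k = rank α (σ k) := by
  classical
  apply Fin.ext
  rw [rank_val, rank_val]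
  refine Finset.card_equiv σ fun j => ?_
  simp [h]

theorem rank_comp_swap {α : Fin (n + 1) → ℕ} {i : Fin n} (hα : α i.castSucc < α i.succ)
    (k : Fin (n + 1)) :
    rank (α ∘ Equiv.swap i.castSucc i.succ) k = rank α (Equiv.swap i.castSucc i.succ k) := by
  set s := Equiv.swap i.castSucc i.succ with hs
  have hss : ∀ j, s (s j) = j := Equiv.swap_apply_self _ _
  refine rank_equiv s (fun j k => ?_) k
  simp only [Precedes, Function.comp_apply]
  refine or_congr_right (and_congr_right fun he => ⟨fun h => ?_, fun h => ?_⟩)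
  · refine RSYT.lt_of_swap_lt i (s k) (s j) (by rwa [← hs, hss, hss]) ?_
    rw [← hs, hss, hss]
    rintro ⟨rfl, rfl⟩
    simp [hs] at he
    omega
  · refine RSYT.lt_of_swap_lt i k j h ?_
    rintro ⟨h1, h2⟩
    rw [h1, h2] at he
    omega

theorem affine_castSucc (α : Fin (n + 1) → ℕ) (i : Fin n) :
    affine α i.castSucc = α i.succ := by simp [affine]

theorem affine_last (α : Fin (n + 1) → ℕ) : affine α (Fin.last n) = α 0 + 1 := by simp [affine]

theorem rank_affine (α : Fin (n + 1) → ℕ) (k : Fin (n + 1)) :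
    rank (affine α) k = rank α (finRotate (n + 1) k) := by
  have h1 : ∀ i : Fin n, finRotate (n + 1) i.castSucc = i.succ := fun i => by
    rw [finRotate_apply, Fin.coeSucc_eq_succ]
  refine rank_equiv _ (fun j k => ?_) k
  induction j using Fin.lastCases with
  | last =>
    induction k using Fin.lastCases with
    | last => simp [Precedes]
    | cast k =>
      have h2 : ¬ Fin.last n < k.castSucc := not_lt.2 (Fin.le_last _)
      simp only [Precedes, affine_last, affine_castSucc, h1, finRotate_last, Fin.succ_pos, and_true,
        h2, and_false, or_false]
      omega
  | cast j =>
    induction k using Fin.lastCases with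
    | last =>
      have h2 : ¬ j.succ < 0 := not_lt.2 (Fin.zero_le _)
      simp only [Precedes, affine_last, affine_castSucc, h1, finRotate_last, Fin.castSucc_lt_last,
        and_true, h2, and_false, or_false]
      omega
    | cast k =>
      simp [Precedes, affine_castSucc, h1]

theorem rank_affine_castSucc (α : Fin (n + 1) → ℕ) (i : Fin n) :
    rank (affine α) i.castSucc = rank α i.succ := by
  rw [rank_affine, finRotate_apply, Fin.coeSucc_eq_succ]

theorem rank_affine_last (α : Fin (n + 1) → ℕ) : rank (affine α) (Fin.last n) = rank α 0 := by
  rw [rank_affine, finRotate_last]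

theorem rank_of_antitone {α : Fin (n + 1) → ℕ} (hα : Antitone α) (i : Fin (n + 1)) :
    rank α i = i := by
  classical
  apply Fin.ext
  rw [rank_val, ← Fin.card_Iio]
  congr 1
  ext j
  simp only [Finset.mem_filter, Finset.mem_univ, true_and, Finset.mem_Iio]
  constructor
  · rintro (h | h)
    · by_contra hcon
      exact absurd (hα (not_lt.1 hcon)) (not_le.2 h)
    · exact h.2
  · intro h
    rcases (hα h.le).lt_or_eq with h1 | h1
    · exact Or.inl h1
    · exact Or.inr ⟨h1.symm, h⟩

theorem rank_succ_of_eq {α : Fin (n + 1) → ℕ} {i : Fin n} (hα : α i.castSucc = α i.succ) :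
    (rank α i.succ : ℕ) = rank α i.castSucc + 1 := by
  classical
  rw [rank_val, rank_val, ← Finset.card_insert_of_notMem (a := i.castSucc)
    (by simp only [Finset.mem_filter, Finset.mem_univ, true_and]; simp [Precedes])]
  congr 1
  ext j
  simp only [Finset.mem_filter, Finset.mem_univ, true_and, Finset.mem_insert]
  simp only [Precedes, hα, Fin.ext_iff, Fin.lt_def, Fin.val_succ, Fin.val_castSucc]
  constructor
  · rintro (h | h)
    · exact Or.inr (Or.inl h)
    · rcases Nat.lt_succ_iff_lt_or_eq.1 h.2 with h' | h'
      · exact Or.inr (Or.inr ⟨h.1, h'⟩)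
      · exact Or.inl h'
  · rintro (h | h | h)
    · right
      have : j = i.castSucc := Fin.ext h
      subst this
      exact ⟨hα, by simp⟩
    · exact Or.inl h
    · exact Or.inr ⟨h.1, by omega⟩

end Rank

/-! ### Spectral vectors -/

section Spectral

variable {K : Type*} [Field K] {n : ℕ} {τ : YoungDiagram}

/-- The pair (part, content) attached to each index by `α` and `S`. -/
def label (α : Fin (n + 1) → ℕ) (S : RSYT n τ) (i : Fin (n + 1)) : ℕ × ℤ :=
  (α i, S.content (rank α i))

theorem spectral_eq (q t : K) (α : Fin (n + 1) → ℕ) (S : RSYT n τ) (i : Fin (n + 1)) :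
    spectral q t α S i = q ^ (label α S i).1 * t ^ (label α S i).2 := rfl

theorem label_comp_swap {α : Fin (n + 1) → ℕ} (S : RSYT n τ) {i : Fin n}
    (hα : α i.castSucc < α i.succ) :
    label (α ∘ Equiv.swap i.castSucc i.succ) S = label α S ∘ Equiv.swap i.castSucc i.succ := by
  funext k
  simp [label, rank_comp_swap hα]

theorem succ_eq_rank {α : Fin (n + 1) → ℕ} {i j : Fin n} (hα : α i.castSucc = α i.succ)
    (hj : j.castSucc = rank α i.castSucc) : j.succ = rank α i.succ := by
  apply Fin.ext
  rw [rank_succ_of_eq hα, ← hj]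
  simp

theorem label_exchange {α : Fin (n + 1) → ℕ} (S : RSYT n τ) {i j : Fin n}
    (hα : α i.castSucc = α i.succ) (hj : j.castSucc = rank α i.castSucc)
    (hc : 2 ≤ S.content j.castSucc - S.content j.succ) :
    label α (S.exchange j) = label α S ∘ Equiv.swap i.castSucc i.succ := by
  funext k
  have h1 : α (Equiv.swap i.castSucc i.succ k) = α k := by
    rw [Equiv.swap_apply_def]
    split_ifs with h h
    · rw [h, hα]
    · rw [h, hα]
    · rfl
  have h2 : Equiv.swap j.castSucc j.succ (rank α k)
      = rank α (Equiv.swap i.castSucc i.succ k) := by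
    rw [hj, succ_eq_rank hα hj]
    exact (rank_injective α).swap_apply _ _ _
  simp only [label, Function.comp_apply, h1, S.content_exchange j (S.row_ne_and_col_ne j hc), h2]

theorem label_affine_castSucc (α : Fin (n + 1) → ℕ) (S : RSYT n τ) (i : Fin n) :
    label (affine α) S i.castSucc = label α S i.succ := by
  simp [label, rank_affine_castSucc, affine_castSucc]

theorem label_affine_last (α : Fin (n + 1) → ℕ) (S : RSYT n τ) :
    label (affine α) S (Fin.last n) = ((label α S 0).1 + 1, (label α S 0).2) := by
  simp [label, rank_affine_last, affine_last]

end Spectral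

/-! ### Products over pairs -/

section PairProd

variable {M X : Type*} [CommMonoid M] {n : ℕ}

/-- The product of `H (f i) (f j)` over all `i < j`. -/
def pairProd (H : X → X → M) (f : Fin n → X) : M :=
  ∏ i, ∏ j, if i < j then H (f i) (f j) else 1

theorem pairProd_eq (H : X → X → M) (f : Fin n → X) :
    pairProd H f = ∏ i, ∏ j ∈ Finset.Ioi i, H (f i) (f j) := by
  refine Finset.prod_congr rfl fun i _ => ?_
  rw [← Finset.prod_filter]
  congr 1
  ext j
  simp

theorem pairProd_succ (H : X → X → M) (f : Fin (n + 1) → X) :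
    pairProd H f = (∏ j : Fin n, H (f 0) (f j.succ)) * pairProd H (fun i => f i.succ) := by
  simp [pairProd, Fin.prod_univ_succ]

theorem pairProd_castSucc (H : X → X → M) (f : Fin (n + 1) → X) :
    pairProd H f = (∏ i : Fin n, H (f i.castSucc) (f (Fin.last n)))
      * pairProd H (fun i => f i.castSucc) := by
  have h : ∀ i : Fin n, ¬ Fin.last n < i.castSucc := fun i => not_lt.2 (Fin.le_last _)
  simp [pairProd, Fin.prod_univ_castSucc, Finset.prod_mul_distrib, Fin.castSucc_lt_last, h,
    mul_comm]

/-- An exchange of two adjacent labels affects only the factor of these two. -/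
theorem pairProd_swap (H : X → X → M) (f : Fin (n + 1) → X) (i : Fin n) :
    ∃ R, pairProd H f = H (f i.castSucc) (f i.succ) * R ∧
      pairProd H (f ∘ Equiv.swap i.castSucc i.succ) = H (f i.succ) (f i.castSucc) * R := by
  classical
  set s := Equiv.swap i.castSucc i.succ with hs
  have hss : ∀ j, s (s j) = j := Equiv.swap_apply_self _ _
  set P : Finset (Fin (n + 1) × Fin (n + 1)) := Finset.univ.filter (fun p => p.1 < p.2) with hP
  have hprod : ∀ g : Fin (n + 1) → X, pairProd H g = ∏ p ∈ P, H (g p.1) (g p.2) := fun g => by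
    rw [hP, Finset.prod_filter, ← Finset.univ_product_univ, Finset.prod_product]
    rfl
  have hmem : (i.castSucc, i.succ) ∈ P := by simp [hP]
  refine ⟨∏ p ∈ P.erase (i.castSucc, i.succ), H (f p.1) (f p.2), ?_, ?_⟩
  · rw [hprod, Finset.mul_prod_erase P (fun p => H (f p.1) (f p.2)) hmem]
  · have hlt : ∀ p ∈ P.erase (i.castSucc, i.succ), (s p.1, s p.2) ∈ P.erase (i.castSucc, i.succ) := by
      rintro ⟨a, b⟩ hp
      simp only [hP, Finset.mem_erase, ne_eq, Prod.mk.injEq, Finset.mem_filter, Finset.mem_univ,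
        true_and] at hp ⊢
      refine ⟨?_, ?_⟩
      · rintro ⟨h1, h2⟩
        have h1' : a = i.succ := by rw [← hss a, h1, hs, Equiv.swap_apply_left]
        have h2' : b = i.castSucc := by rw [← hss b, h2, hs, Equiv.swap_apply_right]
        rw [h1', h2'] at hp
        exact absurd hp.2 (not_lt.2 Fin.castSucc_lt_succ.le)
      · refine RSYT.lt_of_swap_lt i (s b) (s a) (by rw [← hs, hss, hss]; exact hp.2) ?_
        rw [← hs, hss, hss]
        exact hp.1
    rw [hprod, ← Finset.mul_prod_erase P _ hmem]
    congr 1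
    · simp [hs]
    · refine Finset.prod_nbij' (fun p => (s p.1, s p.2)) (fun p => (s p.1, s p.2)) hlt hlt ?_ ?_ ?_
      · intro p _; simp [hss]
      · intro p _; simp [hss]
      · intro p _; rfl

end PairProd

/-! ### The closed form of the norm -/

section Norm

variable {K : Type*} [Field K] {n : ℕ} {τ : YoungDiagram}

/-- The contribution to the norm of a pair of labels (part, content), the first standing to the
left of the second. Natural number subtraction makes one of the two products empty. -/
def pairFactor (q t : K) (x y : ℕ × ℤ) : K :=
  (∏ l ∈ Finset.range (x.1 - y.1), u t (q ^ (l + 1) * t ^ (x.2 - y.2)))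
    * ∏ l ∈ Finset.range (y.1 - x.1 - 1), u t (q ^ (l + 1) * t ^ (y.2 - x.2))

/-- The contribution to the norm of a single label. -/
def singleFactor (q t : K) (x : ℕ × ℤ) : K :=
  ∏ l ∈ Finset.range x.1, (1 - q ^ (l + 1) * t ^ x.2) / (1 - q)

/-- The value of `‖M_{α,S}‖²` for an arbitrary composition `α`. -/
def normValue (q t : K) (α : Fin (n + 1) → ℕ) (S : RSYT n τ) : K :=
  tableauNorm t S * (∏ i, singleFactor q t (label α S i)) * pairProd (pairFactor q t) (label α S)

theorem tableauNorm_eq (t : K) (S : RSYT n τ) :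
    tableauNorm t S = pairProd (fun x y : ℤ => if 2 ≤ y - x then u t (t ^ (x - y)) else 1)
      S.content := by
  refine Finset.prod_congr rfl fun i _ => ?_
  rw [Finset.prod_filter]
  refine Finset.prod_congr rfl fun j _ => ?_
  split_ifs <;> simp_all

theorem tableauNorm_exchange (t : K) (S : RSYT n τ) (j : Fin n)
    (hc : 2 ≤ S.content j.castSucc - S.content j.succ) :
    tableauNorm t (S.exchange j)
      = u t (t ^ (S.content j.succ - S.content j.castSucc)) * tableauNorm t S := by
  have h : (S.exchange j).content = S.content ∘ Equiv.swap j.castSucc j.succ :=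
    funext (S.content_exchange j (S.row_ne_and_col_ne j hc))
  obtain ⟨R, h1, h2⟩ := pairProd_swap
    (fun x y : ℤ => if 2 ≤ y - x then u t (t ^ (x - y)) else 1) S.content j
  rw [tableauNorm_eq, tableauNorm_eq, h, h1, h2, if_pos hc, if_neg (by omega), one_mul]

theorem normValue_zero (q t : K) (S : RSYT n τ) :
    normValue q t (fun _ => 0) S = tableauNorm t S := by
  simp [normValue, pairProd, label, singleFactor, pairFactor]

theorem normValue_comp_swap {q t : K} (hq : q ≠ 0) (ht : t ≠ 0) {α : Fin (n + 1) → ℕ}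
    (S : RSYT n τ) {i : Fin n} (hα : α i.castSucc < α i.succ) :
    normValue q t (α ∘ Equiv.swap i.castSucc i.succ) S
      = u t (spectral q t α S i.succ / spectral q t α S i.castSucc) * normValue q t α S := by
  obtain ⟨R, h1, h2⟩ := pairProd_swap (pairFactor q t) (label α S) i
  have h3 : ∏ k, singleFactor q t ((label α S ∘ Equiv.swap i.castSucc i.succ) k)
      = ∏ k, singleFactor q t (label α S k) :=
    Equiv.prod_comp (Equiv.swap i.castSucc i.succ) (fun k => singleFactor q t (label α S k))
  have h4 : pairFactor q t (label α S i.succ) (label α S i.castSucc)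
      = u t (spectral q t α S i.succ / spectral q t α S i.castSucc)
        * pairFactor q t (label α S i.castSucc) (label α S i.succ) := by
    obtain ⟨m, hm⟩ : ∃ m, α i.succ = α i.castSucc + (m + 1) := ⟨α i.succ - α i.castSucc - 1, by omega⟩
    have e1 : (label α S i.succ).1 - (label α S i.castSucc).1 = m + 1 := by
      simp only [label]; omega
    have e2 : (label α S i.castSucc).1 - (label α S i.succ).1 = 0 := by
      simp only [label]; omega
    rw [pairFactor, pairFactor, e1, e2, Nat.add_sub_cancel, Finset.prod_range_succ, spectral_eq,
      spectral_eq]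
    have e3 : q ^ (label α S i.succ).1 * t ^ (label α S i.succ).2
        / (q ^ (label α S i.castSucc).1 * t ^ (label α S i.castSucc).2)
        = q ^ (m + 1) * t ^ ((label α S i.succ).2 - (label α S i.castSucc).2) := by
      have : (label α S i.succ).1 = (label α S i.castSucc).1 + (m + 1) := hm
      rw [this, pow_add, zpow_sub₀ ht]
      field_simp
    rw [e3]
    simp
    ring
  rw [normValue, normValue, label_comp_swap S hα, h3, h1, h2, h4]
  ring

theorem normValue_exchange {q t : K} (hq : q ≠ 0) (ht : t ≠ 0) {α : Fin (n + 1) → ℕ}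
    (S : RSYT n τ) {i j : Fin n} (hα : α i.castSucc = α i.succ)
    (hj : j.castSucc = rank α i.castSucc)
    (hc : 2 ≤ S.content j.castSucc - S.content j.succ) :
    normValue q t α (S.exchange j)
      = u t (spectral q t α S i.succ / spectral q t α S i.castSucc) * normValue q t α S := by
  obtain ⟨R, h1, h2⟩ := pairProd_swap (pairFactor q t) (label α S) i
  have h3 : ∏ k, singleFactor q t ((label α S ∘ Equiv.swap i.castSucc i.succ) k)
      = ∏ k, singleFactor q t (label α S k) :=
    Equiv.prod_comp (Equiv.swap i.castSucc i.succ) (fun k => singleFactor q t (label α S k))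
  have h4 : pairFactor q t (label α S i.succ) (label α S i.castSucc) = 1 := by
    simp [pairFactor, label, hα]
  have h5 : pairFactor q t (label α S i.castSucc) (label α S i.succ) = 1 := by
    simp [pairFactor, label, hα]
  have h6 : spectral q t α S i.succ / spectral q t α S i.castSucc
      = t ^ (S.content j.succ - S.content j.castSucc) := by
    rw [spectral, spectral, hα, ← succ_eq_rank hα hj, ← hj, zpow_sub₀ ht]
    field_simp
  rw [normValue, normValue, label_exchange S hα hj hc, h3, h1, h2, h4, h5, h6,
    tableauNorm_exchange t S j hc]
  ring

theorem normValue_affine (q t : K) (α : Fin (n + 1) → ℕ) (S : RSYT n τ) :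
    normValue q t (affine α) S = (1 - q * spectral q t α S 0) / (1 - q) * normValue q t α S := by
  have h1 : ∏ i, singleFactor q t (label (affine α) S i)
      = (1 - q * spectral q t α S 0) / (1 - q) * ∏ i, singleFactor q t (label α S i) := by
    rw [Fin.prod_univ_castSucc, Fin.prod_univ_succ, label_affine_last, spectral_eq]
    simp only [label_affine_castSucc]
    rw [singleFactor, Finset.prod_range_succ, singleFactor, pow_succ]
    ring
  have h2 : pairProd (pairFactor q t) (label (affine α) S)
      = pairProd (pairFactor q t) (label α S) := by
    rw [pairProd_castSucc, pairProd_succ]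
    simp only [label_affine_castSucc]
    congr 1
    refine Finset.prod_congr rfl fun i _ => ?_
    rw [label_affine_last]
    generalize label α S i.succ = x
    generalize label α S 0 = y
    simp only [pairFactor]
    rw [mul_comm, Nat.sub_right_comm, Nat.add_sub_cancel, Nat.sub_sub]
  rw [normValue, normValue, h1, h2]
  ring

end Norm

/-! ### Eigenvectors of the Cherednik operators -/

section Eigen

open MvPolynomial

variable {K : Type*} [Field K] {n : ℕ} {τ : YoungDiagram}

theorem piOp_one (t : K) (i : Fin n) : piOp t i 1 = 0 := by
  have h := mul_divDiff (K := K) i 1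
  rw [map_one (swapVars K i), sub_self] at h
  rw [piOp_apply, (mul_eq_zero.1 h).resolve_left (sub_ne_zero_vars i)]
  simp

theorem heckeT_one_tmul (t : K) (i : Fin n) (v : V K n τ) :
    heckeT τ t i (1 ⊗ₜ v) = 1 ⊗ₜ tauT t i v := by
  rw [heckeT_eq, LinearMap.add_apply, boxOp_tmul, boxOp_tmul, piOp_one, TensorProduct.zero_tmul,
    zero_add, swapOp_apply, map_one]

theorem ascProd_one_tmul {m : ℕ} (T : Fin m → Module.End K (PolyV K n τ))
    (A : Fin m → Module.End K (V K n τ)) (h : ∀ i v, T i (1 ⊗ₜ v) = 1 ⊗ₜ A i v) (v : V K n τ) :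
    ascProd T (1 ⊗ₜ v) = 1 ⊗ₜ ascProd A v := by
  induction m with
  | zero => rfl
  | succ m ih =>
    rw [ascProd_succ_last, ascProd_succ_last, Module.End.mul_apply, ih _ _ fun i => h i.castSucc, h]
    rfl

theorem opXiLast_one_tmul {t : K} (ht : Separates n t) (q : K) (v : V K n τ) :
    opXiLast q t (1 ⊗ₜ v) = 1 ⊗ₜ v := by
  obtain ⟨v, rfl⟩ := tauOmega_surjective ht v
  have h1 := ascProd_one_tmul (heckeT τ t) (fun i => tauT t i) (heckeT_one_tmul t) v
  have h2 : (1 : Poly K n) ⊗ₜ[K] tauOmega t v = ascProd (heckeT τ t) (1 ⊗ₜ v) := h1.symm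
  conv_lhs => rw [h2]
  rw [← Module.End.mul_apply, opXiLast_mul_ascProd ht, wOp_eq, boxOp_tmul]
  simp only [AlgHom.toLinearMap_apply, map_one]
  rfl

/-- On constants the Cherednik operators act as Jucys–Murphy elements. -/
theorem xiOp_one_tmul {t : K} (ht : Separates n t) (q : K) (k : Fin (n + 1)) (S : RSYT n τ) :
    xiOp τ q t k (1 ⊗ₜ basisVec K S) = t ^ S.content k • (1 ⊗ₜ basisVec K S) := by
  induction k using Fin.reverseInduction generalizing S with
  | last => rw [xiOp_last, opXiLast_one_tmul ht, S.content_last, zpow_zero, one_smul]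
  | cast i ih =>
    obtain ⟨h1, h2⟩ := tauT_basisVec (K := K) ht i S
    have hc : S.content i.castSucc ≠ S.content i.succ :=
      S.content_ne Fin.castSucc_lt_succ (by simp)
    have hne := ht.content_ne S hc
    have hT : heckeT τ t i (1 ⊗ₜ basisVec K S)
        = diagCoeff t (S.content i.castSucc) (S.content i.succ) • (1 ⊗ₜ[K] basisVec K S)
          + offCoeff t (S.content i.castSucc) (S.content i.succ)
            • (1 ⊗ₜ[K] basisVec K (S.exchange i)) := by
      rw [heckeT_one_tmul, h1, TensorProduct.tmul_add, TensorProduct.tmul_smul,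
        TensorProduct.tmul_smul]
    rw [xiOp_castSucc, LinearMap.smul_apply, Module.End.mul_apply, Module.End.mul_apply,
      inv_smul_eq_iff₀ ht.1, hT, map_add, map_smul, map_smul, ih, ih, map_add, map_smul, map_smul,
      map_smul, map_smul, hT]
    have hn := sub_ne_zero.2 hne
    have hn' := sub_ne_zero.2 hne.symm
    -- either `i` and `i + 1` share a row or column, and `1 ⊗ S` is an eigenvector of `𝐓_i`, or the
    -- exchanged tableau is genuine and spans a two-dimensional invariant space with `S`
    rcases h2 with h2 | h2
    · have hd : diagCoeff t (S.content i.castSucc) (S.content i.succ) ^ 2 * t ^ S.content i.succ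
          = t * t ^ S.content i.castSucc := by
        have hg := offCoeff_mul ht.1 hne
        rw [h2, zero_mul, eq_comm, div_eq_zero_iff] at hg
        have hg' := hg.resolve_right (pow_ne_zero _ hn)
        rw [diagCoeff, div_pow, div_mul_eq_mul_div, div_eq_iff (pow_ne_zero _ hn)]
        linear_combination (-t ^ S.content i.castSucc) * hg'
      rw [h2]
      simp only [zero_smul, add_zero, smul_smul, zero_mul]
      congr 1
      linear_combination hd
    · have hx : (S.exchange i).content i.castSucc = S.content i.succ := by
        rw [S.content_exchange i h2, Equiv.swap_apply_left]
      have hy : (S.exchange i).content i.succ = S.content i.castSucc := by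
        rw [S.content_exchange i h2, Equiv.swap_apply_right]
      have hxx : (S.exchange i).exchange i = S := by
        apply RSYT.filling_injective
        have h3 : (S.exchange i).row i.castSucc ≠ (S.exchange i).row i.succ
            ∧ (S.exchange i).col i.castSucc ≠ (S.exchange i).col i.succ := by
          rw [S.row_exchange i h2, S.row_exchange i h2, S.col_exchange i h2, S.col_exchange i h2]
          simpa using ⟨Ne.symm h2.1, Ne.symm h2.2⟩
        rw [filling_exchange _ i h3, filling_exchange _ i h2, Function.comp_assoc,
          Filling.comp_swap_comp_swap]
      have hT' : heckeT τ t i (1 ⊗ₜ basisVec K (S.exchange i))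
          = diagCoeff t (S.content i.succ) (S.content i.castSucc)
              • (1 ⊗ₜ[K] basisVec K (S.exchange i))
            + offCoeff t (S.content i.succ) (S.content i.castSucc) • (1 ⊗ₜ[K] basisVec K S) := by
        rw [heckeT_one_tmul, (tauT_basisVec (K := K) ht i _).1, TensorProduct.tmul_add,
          TensorProduct.tmul_smul, TensorProduct.tmul_smul, hx, hy, hxx]
      have hg := offCoeff_mul ht.1 hne
      have c1 : diagCoeff t (S.content i.castSucc) (S.content i.succ) ^ 2 * t ^ S.content i.succ
          + offCoeff t (S.content i.castSucc) (S.content i.succ)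
            * offCoeff t (S.content i.succ) (S.content i.castSucc) * t ^ S.content i.castSucc
          = t * t ^ S.content i.castSucc := by
        rw [hg, diagCoeff]
        field_simp
        ring
      have c2 : diagCoeff t (S.content i.castSucc) (S.content i.succ) * t ^ S.content i.succ
          + diagCoeff t (S.content i.succ) (S.content i.castSucc) * t ^ S.content i.castSucc
          = 0 := by
        simp only [diagCoeff]
        field_simp
        ring
      rw [hy, hT']
      match_scalars
      · linear_combination c1
      · linear_combination offCoeff t (S.content i.castSucc) (S.content i.succ) * c2

/-- The property of being a simultaneous eigenvector of the Cherednik operators with spectral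
vector `ζ`. -/
def IsXiEigen (q t : K) (ζ : Fin (n + 1) → K) (M : PolyV K n τ) : Prop :=
  ∀ k, xiOp τ q t k M = ζ k • M

/-- The intertwiner `𝐓_i + (t - 1) / (ζ_{i+1} / ζ_i - 1)` exchanges `ζ_i` and `ζ_{i+1}`. -/
theorem IsXiEigen.step {q t : K} (ht : Separates n t) {ζ : Fin (n + 1) → K} {M : PolyV K n τ}
    (hM : IsXiEigen q t ζ M) (i : Fin n) (h0 : ζ i.castSucc ≠ 0)
    (hne : ζ i.succ ≠ ζ i.castSucc) :
    IsXiEigen q t (ζ ∘ Equiv.swap i.castSucc i.succ)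
      (heckeT τ t i M + ((t - 1) / (ζ i.succ / ζ i.castSucc - 1)) • M) := by
  have hb : (t - 1) / (ζ i.succ / ζ i.castSucc - 1) * (ζ i.succ - ζ i.castSucc)
      = (t - 1) * ζ i.castSucc := by
    have := sub_ne_zero.2 hne
    field_simp
  generalize (t - 1) / (ζ i.succ / ζ i.castSucc - 1) = b at hb
  have hr := smul_xiOp_castSucc (τ := τ) ht.1 q i
  have hquad := heckeT_quadratic (τ := τ) ht i
  have ht0 := ht.1
  have e1 : xiOp τ q t i.castSucc * heckeT τ t i
      = (t - 1) • xiOp τ q t i.castSucc + heckeT τ t i * xiOp τ q t i.succ := by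
    have : t • (xiOp τ q t i.castSucc * heckeT τ t i)
        = t • ((t - 1) • xiOp τ q t i.castSucc + heckeT τ t i * xiOp τ q t i.succ) := by
      rw [← smul_mul_assoc, ← hr, mul_assoc, hquad, mul_add, mul_smul_comm, hr, mul_smul_comm,
        mul_one]
      module
    exact smul_right_injective _ ht0 this
  have e2 : xiOp τ q t i.succ * heckeT τ t i
      = heckeT τ t i * xiOp τ q t i.castSucc + (1 - t) • xiOp τ q t i.castSucc := by
    have h3 : heckeTInv τ t i * (t • xiOp τ q t i.castSucc) = xiOp τ q t i.succ * heckeT τ t i := by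
      rw [← hr, ← mul_assoc, ← mul_assoc, heckeTInv_mul ht, one_mul]
    rw [← h3, heckeTInv_eq, smul_mul_assoc, mul_smul_comm, inv_smul_smul₀ ht0, add_mul,
      smul_mul_assoc, one_mul]
  have e1' := LinearMap.congr_fun e1 M
  have e2' := LinearMap.congr_fun e2 M
  simp only [Module.End.mul_apply, LinearMap.add_apply, LinearMap.smul_apply, hM _, map_smul]
    at e1' e2'
  intro k
  by_cases h1 : k = i.castSucc
  · subst h1
    rw [Function.comp_apply, Equiv.swap_apply_left, map_add, map_smul, e1', hM]
    match_scalars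
    · linear_combination -hb
    · ring
  by_cases h2 : k = i.succ
  · subst h2
    rw [Function.comp_apply, Equiv.swap_apply_right, map_add, map_smul, e2', hM]
    match_scalars
    · ring
    · linear_combination hb
  have h3 := LinearMap.congr_fun (heckeT_mul_xiOp (τ := τ) ht q i k h1 h2) M
  simp only [Module.End.mul_apply, hM k, map_smul] at h3
  rw [Function.comp_apply, Equiv.swap_apply_of_ne_of_ne h1 h2, map_add, map_smul, ← h3, hM,
    smul_add, smul_comm]

theorem IsXiEigen.affine {q t : K} (ht : Separates n t) {ζ : Fin (n + 1) → K} {M : PolyV K n τ}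
    (hM : IsXiEigen q t ζ M) :
    IsXiEigen q t (Fin.snoc (α := fun _ => K) (fun i : Fin n => ζ i.succ) (q * ζ 0))
      (affineOp τ n q t M) := by
  intro k
  induction k using Fin.lastCases with
  | last =>
    have := LinearMap.congr_fun (xiOp_last_mul_affineOp (τ := τ) ht q) M
    rw [LinearMap.smul_apply, Module.End.mul_apply, Module.End.mul_apply, hM, map_smul,
      smul_smul] at this
    rw [this, Fin.snoc_last]
  | cast i =>
    have := LinearMap.congr_fun (xiOp_mul_affineOp (τ := τ) ht q i) M
    rw [Module.End.mul_apply, Module.End.mul_apply, hM, map_smul] at this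
    rw [this, Fin.snoc_castSucc]

end Eigen

/-! ### Norms along the Yang–Baxter graph -/

section Form

open MvPolynomial

variable {K : Type*} [Field K] {n : ℕ} {τ : YoungDiagram} {q t : K}
  {B : PolyV K n τ →ₗ[K] PolyV K n τ →ₗ[K] K}

theorem BF2.apply_heckeT (hB : BF2 q t B) (i : Fin n) (f g : PolyV K n τ) :
    B (heckeT τ t i f) g = B f (heckeT τ t i g) := hB.hecke i f g

theorem BF2.apply_xiOp (hB : BF2 q t B) (k : Fin (n + 1)) (f g : PolyV K n τ) :
    B (xiOp τ q t k f) g = B f (xiOp τ q t k g) := by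
  induction k using Fin.reverseInduction generalizing f g with
  | last => rw [xiOp_last]; exact hB.xi f g
  | cast i ih =>
    simp only [xiOp_castSucc, LinearMap.smul_apply, Module.End.mul_apply, map_smul, hB.apply_heckeT, ih]

theorem adjoint_ascProd {W : Type*} [AddCommGroup W] [Module K W] (B : W →ₗ[K] W →ₗ[K] K) {m : ℕ}
    (T : Fin m → Module.End K W) (h : ∀ i f g, B (T i f) g = B f (T i g)) (f g : W) :
    B (ascProd T f) g = B f (descProd T g) := by
  induction m generalizing f g with
  | zero => rfl
  | succ m ih =>
    rw [ascProd_succ_last, descProd_succ_last, Module.End.mul_apply, Module.End.mul_apply, h,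
      ih _ fun i => h i.castSucc]

/-- `𝐰*` is the adjoint of `𝐰`. -/
theorem BF2.apply_wOp (hB : BF2 q t B) (ht : Separates n t) (f g : PolyV K n τ) :
    B (wOp τ n q t f) g = B f (opWStar q t g) := by
  rw [← opXiLast_mul_ascProd ht, Module.End.mul_apply, hB.xi,
    adjoint_ascProd B _ fun i => hB.apply_heckeT i]
  rfl

/-- The intertwining step multiplies the norm by `u(ζ_{i+1} / ζ_i)`, because `M` and its image are
orthogonal. -/
theorem BF2.norm_step (hB : BF2 q t B) (ht : Separates n t) {ζ : Fin (n + 1) → K}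
    {M : PolyV K n τ} (hM : IsXiEigen q t ζ M) (i : Fin n) (h0 : ζ i.castSucc ≠ 0)
    (hne : ζ i.succ ≠ ζ i.castSucc) :
    B (heckeT τ t i M + ((t - 1) / (ζ i.succ / ζ i.castSucc - 1)) • M)
        (heckeT τ t i M + ((t - 1) / (ζ i.succ / ζ i.castSucc - 1)) • M)
      = u t (ζ i.succ / ζ i.castSucc) * B M M := by
  have hM' := hM.step ht i h0 hne i.castSucc
  have hz : ζ i.succ / ζ i.castSucc - 1 ≠ 0 := by
    rw [sub_ne_zero, Ne, div_eq_one_iff_eq h0]; exact hne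
  set z := ζ i.succ / ζ i.castSucc with hzdef
  set b := (t - 1) / (z - 1) with hb
  have hbz : b * (z - 1) = t - 1 := div_mul_cancel₀ _ hz
  set M' := heckeT τ t i M + b • M with hMM
  have orth : B M' M = 0 := by
    have h1 := hB.apply_xiOp i.castSucc M' M
    rw [hM', hM, map_smul, map_smul, LinearMap.smul_apply, Function.comp_apply,
      Equiv.swap_apply_left, smul_eq_mul, smul_eq_mul] at h1
    have h2 : (ζ i.succ - ζ i.castSucc) * B M' M = 0 := by linear_combination h1
    exact (mul_eq_zero.1 h2).resolve_left (sub_ne_zero.2 hne)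
  have h1 : B (heckeT τ t i M) M = -b * B M M := by
    rw [hMM, map_add, map_smul, LinearMap.add_apply, LinearMap.smul_apply, smul_eq_mul] at orth
    linear_combination orth
  have h2 : B (heckeT τ t i M) (heckeT τ t i M)
      = (t - 1) * (-b * B M M) + t * B M M := by
    have := LinearMap.congr_fun (heckeT_quadratic (τ := τ) ht i) M
    rw [Module.End.mul_apply, LinearMap.add_apply, LinearMap.smul_apply, LinearMap.smul_apply,
      Module.End.one_apply] at this
    rw [← hB.apply_heckeT, this, map_add, map_smul, map_smul, LinearMap.add_apply, LinearMap.smul_apply,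
      LinearMap.smul_apply, h1, smul_eq_mul, smul_eq_mul]
  have hu : u t z = (1 - b) * (t + b) := by
    have hz' : 1 - z ≠ 0 := fun h => hz (by linear_combination -h)
    rw [u, hb]
    field_simp
    ring
  have h3 : B M' M' = B (heckeT τ t i M) M' := by
    have : B M M' = 0 := by rw [hB.symm, orth]
    have e : B M' = B (heckeT τ t i M) + b • B M := by rw [hMM, map_add, map_smul]
    rw [LinearMap.congr_fun e M', LinearMap.add_apply, LinearMap.smul_apply, this, smul_zero,
      add_zero]
  rw [h3, hMM, map_add, map_smul, h1, h2, hu, smul_eq_mul]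
  ring

theorem divLast_xOp (f : PolyV K n τ) :
    TensorProduct.map (divLast K n) LinearMap.id (xOp K τ (Fin.last n) f) = f := by
  have h : (divLast K n : Module.End K (Poly K n)) * LinearMap.mulLeft K (X (Fin.last n)) = 1 :=
    LinearMap.ext fun p => X_mul_divMonomial (Fin.last n) p
  have : boxOp (divLast K n) 1 * xOp K τ (Fin.last n) = 1 := by
    rw [xOp, boxOp_mul, h, mul_one, boxOp_one]
  exact LinearMap.congr_fun this f

/-- The affine step multiplies the norm by `(1 - q ζ_1) / (1 - q)`: the Dunkl operator sends the
new polynomial to `(1 - q ζ_1) f 𝐰`. -/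
theorem BF2.norm_affine (hB : BF2 q t B) (ht : Separates n t) (hq : q ≠ 0) (hq1 : 1 - q ≠ 0)
    {ζ : Fin (n + 1) → K} {M : PolyV K n τ} (hM : IsXiEigen q t ζ M) :
    B (affineOp τ n q t M) (affineOp τ n q t M) = (1 - q * ζ 0) / (1 - q) * B M M := by
  obtain ⟨h, hh⟩ := opWStar_surjective (τ := τ) hq ht M
  have h1 := hB.dunkl (affineOp τ n q t M) h
  have h2 : opDLast q t (affineOp τ n q t M) = (1 - q * ζ 0) • wOp τ n q t M := by
    have := hM.affine ht (Fin.last n)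
    rw [xiOp_last, Fin.snoc_last] at this
    rw [opDLast, LinearMap.comp_apply, LinearMap.sub_apply, this, LinearMap.id_apply]
    have h3 : affineOp τ n q t M - (q * ζ 0) • affineOp τ n q t M
        = (1 - q * ζ 0) • xOp K τ (Fin.last n) (wOp τ n q t M) := by
      rw [affineOp, Module.End.mul_apply]
      module
    rw [h3, map_smul, divLast_xOp]
  rw [h2, map_smul, LinearMap.smul_apply, hB.apply_wOp ht, hh, smul_eq_mul] at h1
  have h4 : mulXLast K n τ (opW q t M) = affineOp τ n q t M := rfl
  rw [h4] at h1
  field_simp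
  linear_combination -h1

theorem Generic.separates (hgen : Generic (n + 1) q t) (ht : t ≠ 0) : Separates n t := by
  refine ⟨ht, fun b hb hbn h => ?_⟩
  rw [abs_le] at hbn
  refine hgen 0 b ?_ ?_ (fun h => hb h.2) (by simpa using h)
  · push_cast; omega
  · push_cast; omega

theorem Generic.one_sub_ne (hgen : Generic (n + 1) q t) : 1 - q ≠ 0 := by
  intro h
  refine hgen 1 0 ?_ ?_ (by simp) ?_
  · push_cast; omega
  · push_cast; omega
  · rw [zpow_one, zpow_zero, mul_one, sub_eq_zero.1 h]

theorem spectral_ne_zero (hq : q ≠ 0) (ht : t ≠ 0) (α : Fin (n + 1) → ℕ) (S : RSYT n τ)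
    (k : Fin (n + 1)) : spectral q t α S k ≠ 0 :=
  mul_ne_zero (pow_ne_zero _ hq) (zpow_ne_zero _ ht)

/-- Labels that differ have different spectral values. -/
theorem Generic.spectral_ne (hgen : Generic (n + 1) q t) (hq : q ≠ 0) (ht : t ≠ 0)
    (α : Fin (n + 1) → ℕ) (S : RSYT n τ) {k l : Fin (n + 1)} (h : label α S k ≠ label α S l) :
    spectral q t α S k ≠ spectral q t α S l := by
  intro he
  have h1 := S.content_sub_le (rank α k) (rank α l)
  have h2 := S.content_sub_le (rank α l) (rank α k)
  refine hgen ((α k : ℤ) - α l) (S.content (rank α k) - S.content (rank α l)) ?_ ?_ ?_ ?_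
  · push_cast; omega
  · push_cast; omega
  · rintro ⟨h3, h4⟩
    exact h (Prod.ext (by simp only [label]; omega) (by simp only [label]; omega))
  · rw [zpow_sub₀ hq, zpow_sub₀ ht, zpow_natCast, zpow_natCast, div_mul_div_comm]
    exact (div_eq_one_iff_eq (spectral_ne_zero hq ht α S l)).2 he

/-- Every polynomial produced by the Yang–Baxter graph is a simultaneous eigenvector of the
Cherednik operators, and its norm has the closed form. -/
theorem eigen_and_norm_of_isMacdonald (hB : BF2 q t B) (hgen : Generic (n + 1) q t) (hq : q ≠ 0)
    (ht : t ≠ 0) {α : Fin (n + 1) → ℕ} {S : RSYT n τ} {M : PolyV K n τ}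
    (h : IsMacdonald q t α S M) :
    IsXiEigen q t (spectral q t α S) M ∧ B M M = normValue q t α S := by
  have hsep := hgen.separates ht
  induction h with
  | root S =>
    refine ⟨fun k => ?_, ?_⟩
    · rw [xiOp_one_tmul hsep, spectral, rank_of_antitone antitone_const, pow_zero, one_mul]
    · rw [hB.const, normValue_zero]
      simp [form₀, basisVec]
  | step α S M i hM hα ih =>
    have hne : spectral q t α S i.succ ≠ spectral q t α S i.castSucc :=
      hgen.spectral_ne hq ht α S fun he => hα.ne' (congrArg Prod.fst he)
    have h0 := spectral_ne_zero hq ht α S i.castSucc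
    refine ⟨?_, ?_⟩
    · have := ih.1.step hsep i h0 hne
      have hs : spectral q t (α ∘ Equiv.swap i.castSucc i.succ) S
          = spectral q t α S ∘ Equiv.swap i.castSucc i.succ := by
        funext k
        rw [spectral_eq, label_comp_swap S hα]
        rfl
      rw [hs]
      exact this
    · rw [normValue_comp_swap hq ht S hα, ← ih.2]
      exact hB.norm_step hsep ih.1 i h0 hne
  | exchange α S M i j hM hα hj hc ih =>
    have hne : spectral q t α S i.succ ≠ spectral q t α S i.castSucc :=
      hgen.spectral_ne hq ht α S fun he => by
        have := congrArg Prod.snd he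
        simp only [label, ← hj, ← succ_eq_rank hα hj] at this
        omega
    have h0 := spectral_ne_zero hq ht α S i.castSucc
    refine ⟨?_, ?_⟩
    · have := ih.1.step hsep i h0 hne
      have hs : spectral q t α (S.exchange j)
          = spectral q t α S ∘ Equiv.swap i.castSucc i.succ := by
        funext k
        rw [spectral_eq, label_exchange S hα hj hc]
        rfl
      rw [hs]
      exact this
    · rw [normValue_exchange hq ht S hα hj hc, ← ih.2]
      exact hB.norm_step hsep ih.1 i h0 hne
  | affine α S M hM ih =>
    refine ⟨?_, ?_⟩
    · have := ih.1.affine hsep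
      have hs : spectral q t (affine α) S = Fin.snoc (α := fun _ => K)
          (fun i : Fin n => spectral q t α S i.succ) (q * spectral q t α S 0) := by
        funext k
        induction k using Fin.lastCases with
        | last =>
          rw [Fin.snoc_last, spectral_eq, spectral_eq, label_affine_last, pow_succ']
          ring
        | cast i => rw [Fin.snoc_castSucc, spectral_eq, spectral_eq, label_affine_castSucc]
      rw [hs]
      exact this
    · rw [normValue_affine, ← ih.2]
      exact hB.norm_affine hsep hq hgen.one_sub_ne ih.1

/-- The Yang–Baxter graph reaches every composition: a positive last part is lowered by the inverse
of the affine step, and a positive part followed by a zero can be moved to the right. -/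
theorem exists_isMacdonald (q t : K) (α : Fin (n + 1) → ℕ) (S : RSYT n τ) :
    ∃ M, IsMacdonald q t α S M := by
  obtain ⟨m, hm⟩ : ∃ m, ∑ i, α i = m := ⟨_, rfl⟩
  induction m generalizing α with
  | zero =>
    have : α = fun _ => 0 := by
      funext i
      exact Finset.sum_eq_zero_iff.1 hm i (Finset.mem_univ i)
    subst this
    exact ⟨_, .root S⟩
  | succ m ih =>
    have key : ∀ (k : Fin (n + 1)) (β : Fin (n + 1) → ℕ), ∑ i, β i = m + 1 → β k ≠ 0 →
        ∃ M, IsMacdonald q t β S M := by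
      intro k
      induction k using Fin.reverseInduction with
      | last =>
        intro β hβ hk
        let γ : Fin (n + 1) → ℕ := Fin.cons (β (Fin.last n) - 1) (fun i : Fin n => β i.castSucc)
        have hγ : β = affine γ := by
          funext k
          induction k using Fin.lastCases with
          | last => simp only [affine_last, γ, Fin.cons_zero]; omega
          | cast k => simp only [affine_castSucc, γ, Fin.cons_succ]
        obtain ⟨M, hM⟩ := ih γ (by
          rw [Fin.sum_univ_castSucc] at hβ
          simp only [Fin.sum_univ_succ, γ, Fin.cons_zero, Fin.cons_succ]
          omega)
        rw [hγ]
        exact ⟨_, .affine γ S M hM⟩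
      | cast k ihk =>
        intro β hβ hk
        by_cases hs : β k.succ = 0
        · obtain ⟨M, hM⟩ := ihk (β ∘ Equiv.swap k.castSucc k.succ)
            (by rw [← hβ]; exact Equiv.sum_comp (Equiv.swap k.castSucc k.succ) β) (by simpa using hk)
          have := IsMacdonald.step _ S M k hM (by simp; omega)
          rw [Function.comp_assoc, ← Equiv.coe_trans, Equiv.swap_swap, Equiv.coe_refl,
            Function.comp_id] at this
          exact ⟨_, this⟩
        · exact ihk β hβ hs
    obtain ⟨k, hk⟩ : ∃ k, α k ≠ 0 := by
      by_contra! hcon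
      simp [hcon] at hm
    exact key k α hm hk

end Form

/-! ### The norm at a partition -/

section Partition

variable {K : Type*} [Field K] {n : ℕ} {τ : YoungDiagram}

theorem prod_u_eq_qPochhammer (q : K) {t : K} (ht : t ≠ 0) (b : ℤ) (m : ℕ) :
    ∏ l ∈ Finset.range m, u t (q ^ (l + 1) * t ^ b)
      = t ^ m * ((qPochhammer (q * t ^ (b - 1)) q m * qPochhammer (q * t ^ (b + 1)) q m)
        / qPochhammer (q * t ^ b) q m ^ 2) := by
  have h : ∀ l, u t (q ^ (l + 1) * t ^ b) = t * (((1 - q * t ^ (b - 1) * q ^ l)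
      * (1 - q * t ^ (b + 1) * q ^ l)) / (1 - q * t ^ b * q ^ l) ^ 2) := fun l => by
    have h1 : t - q ^ (l + 1) * t ^ b = t * (1 - q * t ^ (b - 1) * q ^ l) := by
      rw [zpow_sub_one₀ ht]
      field_simp
      ring
    have h2 : 1 - q ^ (l + 1) * t ^ b * t = 1 - q * t ^ (b + 1) * q ^ l := by
      rw [zpow_add_one₀ ht]
      ring
    have h3 : 1 - q ^ (l + 1) * t ^ b = 1 - q * t ^ b * q ^ l := by ring
    rw [u, h1, h2, h3]
    ring
  simp only [h, qPochhammer, Finset.prod_mul_distrib, Finset.prod_div_distrib, Finset.prod_pow,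
    Finset.prod_const, Finset.card_range]

theorem singleFactor_eq (q t : K) (m : ℕ) (c : ℤ) :
    singleFactor q t (m, c) = qPochhammer (q * t ^ c) q m * ((1 - q) ^ m)⁻¹ := by
  rw [singleFactor, Finset.prod_div_distrib, Finset.prod_const, Finset.card_range, div_eq_mul_inv,
    qPochhammer]
  congr 1
  exact Finset.prod_congr rfl fun l _ => by ring

theorem kStat_eq {lam : Fin (n + 1) → ℕ} (hlam : Antitone lam) :
    kStat lam = ((∑ i, ∑ j ∈ Finset.Ioi i, (lam i - lam j) : ℕ) : ℤ) := by
  have h1 : ((∑ i, ∑ j ∈ Finset.Ioi i, (lam i - lam j) : ℕ) : ℤ)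
      = ∑ i, ∑ j ∈ Finset.Ioi i, ((lam i : ℤ) - lam j) := by
    push_cast
    refine Finset.sum_congr rfl fun i _ => Finset.sum_congr rfl fun j hj => ?_
    rw [Nat.cast_sub (hlam (Finset.mem_Ioi.1 hj).le)]
  have h2 : ∑ i, ∑ j ∈ Finset.Ioi i, (lam j : ℤ) = ∑ j, ∑ _i ∈ Finset.Iio j, (lam j : ℤ) :=
    Finset.sum_comm' (by simp)
  rw [h1]
  simp only [Finset.sum_sub_distrib]
  rw [h2, ← Finset.sum_sub_distrib, kStat]
  refine Finset.sum_congr rfl fun i _ => ?_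
  have : (i : ℕ) ≤ n := Nat.lt_succ_iff.1 i.2
  simp only [Finset.sum_const, Fin.card_Ioi, Fin.card_Iio, nsmul_eq_mul, Nat.add_sub_cancel]
  push_cast [this]
  ring

theorem normValue_of_antitone {q t : K} (ht : t ≠ 0) {lam : Fin (n + 1) → ℕ} (hlam : Antitone lam)
    (S : RSYT n τ) :
    normValue q t lam S
      = t ^ kStat lam * tableauNorm t S * ((1 - q) ^ (∑ i, lam i))⁻¹
          * (∏ i, qPochhammer (q * t ^ S.content i) q (lam i))
          * ∏ i, ∏ j ∈ Finset.Ioi i,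
              (qPochhammer (q * t ^ (S.content i - S.content j - 1)) q (lam i - lam j)
                * qPochhammer (q * t ^ (S.content i - S.content j + 1)) q (lam i - lam j))
              / qPochhammer (q * t ^ (S.content i - S.content j)) q (lam i - lam j) ^ 2 := by
  have hl : label lam S = fun i => (lam i, S.content i) := by
    funext i
    rw [label, rank_of_antitone hlam]
  have h1 : pairProd (pairFactor q t) (label lam S)
      = t ^ kStat lam * ∏ i, ∏ j ∈ Finset.Ioi i,
              (qPochhammer (q * t ^ (S.content i - S.content j - 1)) q (lam i - lam j)
                * qPochhammer (q * t ^ (S.content i - S.content j + 1)) q (lam i - lam j))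
              / qPochhammer (q * t ^ (S.content i - S.content j)) q (lam i - lam j) ^ 2 := by
    rw [kStat_eq hlam, zpow_natCast, ← Finset.prod_pow_eq_pow_sum]
    simp only [← Finset.prod_pow_eq_pow_sum]
    rw [← Finset.prod_mul_distrib, pairProd_eq]
    refine Finset.prod_congr rfl fun i _ => ?_
    rw [← Finset.prod_mul_distrib]
    refine Finset.prod_congr rfl fun j hj => ?_
    have : lam j ≤ lam i := hlam (Finset.mem_Ioi.1 hj).le
    simp only [hl, pairFactor]
    rw [show lam j - lam i - 1 = 0 by omega, Finset.prod_range_zero, mul_one,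
      prod_u_eq_qPochhammer q ht]
  rw [normValue, h1, hl]
  simp only [singleFactor_eq, Finset.prod_mul_distrib, Finset.prod_inv_distrib,
    Finset.prod_pow_eq_pow_sum]
  ring

end Partition

end VectorMacdonald

theorem mainTheorem2 {K : Type*} [Field K] (n : ℕ) (τ : YoungDiagram) (hτ : τ.card = n + 1)
    (q t : K) (hq : q ≠ 0) (ht : t ≠ 0) (hgen : Generic (n + 1) q t)
    (B : PolyV K n τ →ₗ[K] PolyV K n τ →ₗ[K] K) (hB : BF2 q t B)
    (lam : Fin (n + 1) → ℕ) (hlam : Antitone lam) (S : RSYT n τ) :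
    (∃ M : PolyV K n τ, IsMacdonald q t lam S M) ∧
    ∀ M : PolyV K n τ, IsMacdonald q t lam S M →
      B M M =
        t ^ kStat lam * form₀ t (basisVec K S) (basisVec K S)
          * ((1 - q) ^ (∑ i, lam i))⁻¹
          * (∏ i, qPochhammer (q * t ^ S.content i) q (lam i))
          * ∏ i, ∏ j ∈ Finset.Ioi i,
              (qPochhammer (q * t ^ (S.content i - S.content j - 1)) q (lam i - lam j)
                * qPochhammer (q * t ^ (S.content i - S.content j + 1)) q (lam i - lam j))
              / qPochhammer (q * t ^ (S.content i - S.content j)) q (lam i - lam j) ^ 2 := by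

  refine ⟨exists_isMacdonald q t lam S, fun M hM => ?_⟩
  have h : form₀ t (basisVec K S) (basisVec K S) = tableauNorm t S := by simp [form₀, basisVec]
  rw [(eigen_and_norm_of_isMacdonald hB hgen hq ht hM).2, h, normValue_of_antitone ht hlam]
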